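/- Let $d\ge 1$ be an integer and $0<\alpha<1$. Let $-\Delta$ be the negative discrete Laplacian on the complex Hilbert space $\ell^2(\mathbb{Z}^d)$, $(-\Delta\varphi)(n)=\sum_{|n-m|_1=1}\big(\varphi(n)-\varphi(m)\big)$, where $|\cdot|_1$ is the $\ell^1$-norm; it is a bounded nonnegative operator, and $(-\Delta)^\alpha$ is defined by the functional calculus. Let $(\delta_n)_{n\in\mathbb{Z}^d}$ be the canonical orthonormal basis, write $(-\Delta)^\alpha(n,m)=\langle\delta_n,(-\Delta)^\alpha\delta_m\rangle$ for the matrix elements, and let $|\cdot|$ be the Euclidean norm on $\mathbb{Z}^d$. Then: (i) For all $n,m\in\mathbb{Z}^d$ with $n\ne m$ one has $(-\Delta)^\alpha(n,m)<0$, and for all $n\in\mathbb{Z}^d$ one has $(-\Delta)^\alpha(n,n)>0$ (in particular, all matrix elements are real). (ii) The following limit exists, along all pairs $(n,m)\in\mathbb{Z}^d\times\mathbb{Z}^d$ with $|n-m|\to\infty$, and has the stated value: $$\lim_{|n-m|\to\infty}|n-m|^{d+2\alpha}\,\big(-(-\Delta)^\alpha(n,m)\big)=K_{d,\alpha},\qquad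 K_{d,\alpha}=\frac{4^\alpha\,\Gamma(d/2+\alpha)}{\pi^{d/2}\,|\Gamma(-\alpha)|}>0.$$ (iii) There exist constants $c_{d,\alpha},C_{d,\alpha}>0$ depending only on $d$ and $\alpha$ such that for all $n,m\in\mathbb{Z}^d$ with $n\ne m$ $$\frac{c_{d,\alpha}}{|n-m|^{d+2\alpha}}\le-(-\Delta)^\alpha(n,m)\le\frac{C_{d,\alpha}}{|n-m|^{d+2\alpha}}.$$ -/

import Mathlib

namespace DiscreteFractionalLaplacian

open scoped InnerProductSpace

/-- The complex Hilbert space `ℓ²(ℤ^d)`. -/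
noncomputable abbrev L2 (d : ℕ) : Type := lp (fun _ : Fin d → ℤ => ℂ) 2

/-- The `ℓ¹`-norm `|x|₁` of a lattice vector. -/
def oneNorm {d : ℕ} (x : Fin d → ℤ) : ℤ := ∑ i, |x i|

/-- The Euclidean norm `|x|` of a lattice vector. -/
noncomputable def euclNorm {d : ℕ} (x : Fin d → ℤ) : ℝ :=
  ‖(WithLp.toLp 2 (fun i => (x i : ℝ)) : EuclideanSpace ℝ (Fin d))‖

/-- The nearest neighbours of `n`, i.e. all `m ∈ ℤ^d` with `|n - m|₁ = 1`
(see `mem_neighbours`); the box only serves to make the set a `Finset`. -/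
noncomputable def neighbours {d : ℕ} (n : Fin d → ℤ) : Finset (Fin d → ℤ) :=
  (Finset.Icc (n - 1) (n + 1)).filter fun m => oneNorm (n - m) = 1

theorem mem_neighbours {d : ℕ} (n m : Fin d → ℤ) :
    m ∈ neighbours n ↔ oneNorm (n - m) = 1 := by
  unfold neighbours
  rw [Finset.mem_filter, and_iff_right_iff_imp]
  intro h
  have key : ∀ i, |n i - m i| ≤ 1 := fun i => by
    have := Finset.single_le_sum (f := fun i => |n i - m i|)
      (fun j _ => abs_nonneg _) (Finset.mem_univ i)
    have h' : ∑ i, |n i - m i| = 1 := h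
    linarith
  rw [Finset.mem_Icc]
  refine ⟨fun i => ?_, fun i => ?_⟩ <;>
  · have := abs_le.1 (key i)
    simp only [Pi.sub_apply, Pi.add_apply, Pi.one_apply]
    omega

/-- The pointwise formula `∑_{|n-m|₁=1} (φ(n) - φ(m))`. -/
noncomputable def negLaplacianFun {d : ℕ} (φ : (Fin d → ℤ) → ℂ) (n : Fin d → ℤ) : ℂ :=
  ∑ m ∈ neighbours n, (φ n - φ m)

theorem oneNorm_single {d : ℕ} (i : Fin d) (a : ℤ) :
    oneNorm (Pi.single i a : Fin d → ℤ) = |a| := by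
  unfold oneNorm
  rw [Finset.sum_eq_single i]
  · simp
  · intro j _ hj; simp [hj]
  · simp

theorem eq_single_of_oneNorm {d : ℕ} (x : Fin d → ℤ) (hx : oneNorm x = 1) :
    ∃ i, x = Pi.single i 1 ∨ x = Pi.single i (-1) := by
  have hx' : ∑ i, |x i| = 1 := hx
  obtain ⟨i, -, hi⟩ : ∃ i ∈ Finset.univ, |x i| ≠ 0 := by
    apply Finset.exists_ne_zero_of_sum_ne_zero; rw [hx']; norm_num
  have h1 : 1 ≤ |x i| := by have := abs_nonneg (x i); omega
  rw [← Finset.add_sum_erase _ _ (Finset.mem_univ i)] at hx'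
  have h0 : 0 ≤ ∑ j ∈ Finset.univ.erase i, |x j| :=
    Finset.sum_nonneg fun j _ => abs_nonneg _
  have h2 : ∑ j ∈ Finset.univ.erase i, |x j| = 0 := by omega
  have h3 : |x i| = 1 := by omega
  rw [Finset.sum_eq_zero_iff_of_nonneg fun j _ => abs_nonneg _] at h2
  have hs : x = Pi.single i (x i) := by
    funext j
    by_cases hj : j = i
    · subst hj; simp
    · have := h2 j (by simp [hj])
      simpa [hj] using this
  refine ⟨i, ?_⟩
  rcases (abs_eq (by norm_num : (0 : ℤ) ≤ 1)).1 h3 with h | h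
  · left; rw [hs, h]
  · right; rw [hs, h]

theorem neighbours_eq {d : ℕ} (n : Fin d → ℤ) :
    neighbours n = Finset.univ.image (fun i => n + Pi.single i 1) ∪
      Finset.univ.image (fun i => n - Pi.single i 1) := by
  ext m
  simp only [mem_neighbours, Finset.mem_union, Finset.mem_image, Finset.mem_univ, true_and]
  constructor
  · intro h
    obtain ⟨i, h | h⟩ := eq_single_of_oneNorm _ h
    · exact Or.inr ⟨i, by rw [← h]; abel⟩
    · refine Or.inl ⟨i, ?_⟩
      rw [Pi.single_neg] at h
      rw [← neg_eq_iff_eq_neg.2 h]; abel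
  · rintro (⟨i, rfl⟩ | ⟨i, rfl⟩)
    · rw [show n - (n + Pi.single i 1) = Pi.single i (-1) by rw [Pi.single_neg]; abel,
        oneNorm_single]; rfl
    · rw [show n - (n - Pi.single i 1) = Pi.single i 1 by abel, oneNorm_single]; rfl

theorem negLaplacianFun_eq {d : ℕ} (φ : (Fin d → ℤ) → ℂ) (n : Fin d → ℤ) :
    negLaplacianFun φ n =
      ∑ i, ((φ n - φ (n + Pi.single i 1)) + (φ n - φ (n - Pi.single i 1))) := by
  have hinj : Function.Injective (fun i : Fin d => (Pi.single i 1 : Fin d → ℤ)) := by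
    intro i j h
    by_contra hij
    have := congrFun h i
    simp [hij] at this
  unfold negLaplacianFun
  rw [neighbours_eq, Finset.sum_union, Finset.sum_image, Finset.sum_image,
    Finset.sum_add_distrib]
  · intro i _ j _ h; exact hinj (sub_right_injective h)
  · intro i _ j _ h; exact hinj (add_right_injective n h)
  · rw [Finset.disjoint_left]
    intro m h1 h2
    simp only [Finset.mem_image, Finset.mem_univ, true_and] at h1 h2
    obtain ⟨i, rfl⟩ := h1
    obtain ⟨j, h⟩ := h2
    have := congrFun h i
    simp only [Pi.sub_apply, Pi.add_apply, Pi.single_eq_same] at this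
    by_cases hij : i = j
    · subst hij; simp at this; omega
    · simp [hij] at this

/-- Translation `(shift v φ)(n) = φ(n + v)` as an isometry of `ℓ²(ℤ^d)`. -/
noncomputable def shift {d : ℕ} (v : Fin d → ℤ) : L2 d →ₗᵢ[ℂ] L2 d where
  toFun φ := ⟨fun n => φ (n + v), by
    have h := (memℓp_gen_iff (by norm_num)).1 (lp.memℓp φ)
    exact (memℓp_gen_iff (by norm_num)).2 ((Equiv.addRight v).summable_iff.2 h)⟩
  map_add' _ _ := rfl
  map_smul' _ _ := rfl
  norm_map' φ := by
    have hp : 0 < (2 : ENNReal).toReal := by norm_num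
    rw [lp.norm_eq_tsum_rpow hp, lp.norm_eq_tsum_rpow hp]
    congr 1
    exact (Equiv.addRight v).tsum_eq (fun n => ‖φ n‖ ^ (2 : ENNReal).toReal)

theorem shift_apply {d : ℕ} (v : Fin d → ℤ) (φ : L2 d) (n : Fin d → ℤ) :
    shift v φ n = φ (n + v) := rfl

/-- The discrete Laplacian as a sum of translations (auxiliary, used for boundedness). -/
noncomputable def shiftSum (d : ℕ) : L2 d →L[ℂ] L2 d :=
  ∑ i : Fin d, (((1 : L2 d →L[ℂ] L2 d) - (shift (Pi.single i 1)).toContinuousLinearMap) +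
    (1 - (shift (-Pi.single i 1)).toContinuousLinearMap))

theorem shiftSum_apply {d : ℕ} (φ : L2 d) (n : Fin d → ℤ) :
    shiftSum d φ n = negLaplacianFun φ n := by
  rw [negLaplacianFun_eq]
  unfold shiftSum
  rw [_root_.sum_apply, lp.coeFn_sum, Finset.sum_apply]
  rfl

/-- The negative discrete Laplacian `-Δ` on `ℓ²(ℤ^d)`,
`(-Δφ)(n) = ∑_{|n-m|₁=1} (φ(n) - φ(m))`, as a bounded operator. -/
noncomputable def negLaplacian (d : ℕ) : L2 d →L[ℂ] L2 d where
  toFun φ := ⟨fun n => negLaplacianFun φ n, by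
    rw [← funext (shiftSum_apply φ)]; exact lp.memℓp _⟩
  map_add' φ ψ := by
    ext n
    change negLaplacianFun (⇑(φ + ψ)) n = negLaplacianFun φ n + negLaplacianFun ψ n
    simp only [← shiftSum_apply, map_add]; rfl
  map_smul' c φ := by
    ext n
    change negLaplacianFun (⇑(c • φ)) n = c • negLaplacianFun φ n
    simp only [← shiftSum_apply, map_smul]; rfl
  cont := by
    refine (shiftSum d).continuous.congr fun φ => ?_
    ext n
    exact shiftSum_apply φ n

theorem negLaplacian_apply {d : ℕ} (φ : L2 d) (n : Fin d → ℤ) :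
    negLaplacian d φ n = ∑ m ∈ neighbours n, (φ n - φ m) := rfl

theorem negLaplacian_eq_shiftSum (d : ℕ) : negLaplacian d = shiftSum d := by
  ext φ n
  exact (shiftSum_apply φ n).symm

theorem adjoint_shift {d : ℕ} (v : Fin d → ℤ) :
    star (shift v).toContinuousLinearMap = (shift (-v)).toContinuousLinearMap := by
  rw [ContinuousLinearMap.star_eq_adjoint, eq_comm, ContinuousLinearMap.eq_adjoint_iff]
  intro φ ψ
  rw [lp.inner_eq_tsum, lp.inner_eq_tsum, ← (Equiv.addRight v).tsum_eq]
  refine tsum_congr fun n => ?_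
  change ⟪φ (n + v + -v), ψ (n + v)⟫_ℂ = ⟪φ n, ψ (n + v)⟫_ℂ
  rw [add_neg_cancel_right]

/-- `-Δ` is a nonnegative operator, so that its real powers by the continuous functional
calculus are the genuine ones. -/
theorem negLaplacian_nonneg (d : ℕ) : 0 ≤ negLaplacian d := by
  rw [negLaplacian_eq_shiftSum]
  unfold shiftSum
  refine Finset.sum_nonneg fun i _ => ?_
  have hmul : (shift (-Pi.single i 1 : Fin d → ℤ)).toContinuousLinearMap *
      (shift (Pi.single i 1 : Fin d → ℤ)).toContinuousLinearMap = 1 := by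
    ext φ n
    change φ (n + -Pi.single i 1 + Pi.single i 1) = φ n
    rw [neg_add_cancel_right]
  have := star_mul_self_nonneg
    (1 - (shift (Pi.single i 1 : Fin d → ℤ)).toContinuousLinearMap)
  rw [star_sub, star_one, adjoint_shift, sub_mul, mul_sub, mul_sub, hmul] at this
  convert this using 1
  simp only [one_mul, mul_one]
  abel

/-- The real power `A ^ α` of a bounded operator on a complex Hilbert space: Mathlib's
`CFC.rpow`, i.e. the continuous functional calculus applied to `x ↦ x ^ α` on `[0, ∞)`. -/
noncomputable def operatorPow {H : Type*} [NormedAddCommGroup H] [InnerProductSpace ℂ H]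
    [CompleteSpace H] (A : H →L[ℂ] H) (α : ℝ) : H →L[ℂ] H :=
  A ^ α

/-- The discrete fractional Laplacian `(-Δ)^α`. -/
noncomputable def fracLaplacian (d : ℕ) (α : ℝ) : L2 d →L[ℂ] L2 d :=
  operatorPow (negLaplacian d) α

/-- The canonical basis vector `δ_n` of `ℓ²(ℤ^d)`. -/
noncomputable def delta {d : ℕ} (n : Fin d → ℤ) : L2 d :=
  lp.single 2 n (1 : ℂ)

/-- The matrix element `A(n, m) = ⟨δ_n, A δ_m⟩`. -/
noncomputable def matrixElement {d : ℕ} (A : L2 d →L[ℂ] L2 d) (n m : Fin d → ℤ) : ℂ :=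
  ⟪delta n, A (delta m)⟫_ℂ

/-- The constant `K_{d,α} = 4^α Γ(d/2 + α) / (π^{d/2} |Γ(-α)|)`. -/
noncomputable def limitConst (d : ℕ) (α : ℝ) : ℝ :=
  (4 : ℝ) ^ α * Real.Gamma ((d : ℝ) / 2 + α) /
    (Real.pi ^ ((d : ℝ) / 2) * |Real.Gamma (-α)|)

end DiscreteFractionalLaplacian

/-!
Everything rests on subordination to the heat semigroup: for `0 < α < 1` and `y ≥ 0`,
`y ^ α = |Γ(-α)|⁻¹ ∫₀^∞ (1 - e^{-ty}) t^{-1-α} dt` (`integral_one_sub_exp_mul_rpow`). In Fourier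
variables `-Δ` is multiplication by `symbol θ = ∑ 2 (1 - cos θ_i)` on the torus, which on matrix
elements follows from polynomials by Weierstrass approximation (`matrixElement_fracLaplacian`), so
no unitary equivalence is needed. Exchanging integrals gives, for `n ≠ m`,
`-(-Δ)^α(n, m) = |Γ(-α)|⁻¹ ∫₀^∞ p_t(n - m) t^{-1-α} dt`, where the heat kernel
`p_t(x) = ∏ i, q_t(x_i)` factorises over the coordinates (`neg_matrixElement_fracLaplacian`).

Signs: `q_t(k)` is a Poisson mixture of counts of walks from `0` to `k`, hence real and positive
(`re_latticeHeat_pos`). The diagonal elements are the torus averages of `symbol ^ α`.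

Asymptotics: with `t = |x|² s`,
`|x|^{d+2α} ∫₀^∞ p_t(x) t^{-1-α} dt = ∫₀^∞ |x|^d p_{|x|² s}(x) s^{-1-α} ds`. The local central limit
theorem (`norm_sqrt_mul_latticeHeat_sub_le`, uniform in the displacement, hence in the direction of
`x`) gives the pointwise limit `(4πs)^{-d/2} e^{-1/(4s)}` of `|x|^d p_{|x|² s}(x)`, whose integral
against `s^{-1-α}` is a Gamma integral (`integral_gaussian_heat`). Dominated convergence applies
since `|x|^d p_{|x|² s}(x) ≤ C min(s, 1)` (`exists_scaledHeat_le`); for small `s` this is the bound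
`p_t(x) ≤ C t |x|^{-d-2}`, obtained by shifting the Fourier contour (`norm_latticeHeat_le`).

The two-sided bounds follow from positivity and the limit, as balls contain only finitely many
lattice points (`exists_bounds_of_tendsto`).
-/

namespace DiscreteFractionalLaplacian

open MeasureTheory Filter Topology Set


/-! ### The torus and the symbol of the Laplacian -/

/-- The uniform probability measure on the circle, realised on `(-π, π] ⊆ ℝ`. -/
noncomputable def angleMeasure : Measure ℝ :=
  ENNReal.ofReal (2 * Real.pi)⁻¹ • volume.restrict (Ioc (-Real.pi) Real.pi)

theorem integral_angleMeasure {E : Type*} [NormedAddCommGroup E] [NormedSpace ℝ E] (f : ℝ → E) :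
    ∫ θ, f θ ∂angleMeasure = (2 * Real.pi)⁻¹ • ∫ θ in (-Real.pi)..Real.pi, f θ := by
  rw [angleMeasure, integral_smul_measure,
    intervalIntegral.integral_of_le (by linarith [Real.pi_pos]),
    ENNReal.toReal_ofReal (by positivity)]

instance : IsProbabilityMeasure angleMeasure := by
  refine ⟨?_⟩
  rw [angleMeasure, Measure.smul_apply, Measure.restrict_apply_univ, Real.volume_Ioc, smul_eq_mul,
    ← ENNReal.ofReal_mul (by positivity), ← ENNReal.ofReal_one]
  congr 1
  field_simp
  ring

/-- The uniform probability measure on the torus of dimension `d`, realised on `(-π, π]^d`. -/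
noncomputable def torusMeasure (d : ℕ) : Measure (Fin d → ℝ) :=
  Measure.pi fun _ => angleMeasure

instance (d : ℕ) : IsProbabilityMeasure (torusMeasure d) := by
  unfold torusMeasure; infer_instance

/-- The Fourier symbol `∑ i, 2 (1 - cos θ_i)` of `-Δ`. -/
noncomputable def symbol {d : ℕ} (θ : Fin d → ℝ) : ℝ := ∑ i, 2 * (1 - Real.cos (θ i))

/-- The plane wave `θ ↦ e^{i x·θ}` of frequency `x ∈ ℤ^d`. -/
noncomputable def planeWave {d : ℕ} (x : Fin d → ℤ) (θ : Fin d → ℝ) : ℂ :=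
  ∏ i, Complex.exp (x i * θ i * Complex.I)

theorem symbol_nonneg {d : ℕ} (θ : Fin d → ℝ) : 0 ≤ symbol θ :=
  Finset.sum_nonneg fun i _ => by linarith [Real.cos_le_one (θ i)]

theorem symbol_le {d : ℕ} (θ : Fin d → ℝ) : symbol θ ≤ 4 * d := by
  calc symbol θ ≤ ∑ _i : Fin d, (4 : ℝ) :=
        Finset.sum_le_sum fun i _ => by linarith [Real.neg_one_le_cos (θ i)]
    _ = 4 * d := by simp [mul_comm]

@[fun_prop]
theorem continuous_symbol {d : ℕ} : Continuous (symbol : (Fin d → ℝ) → ℝ) := by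
  unfold symbol; fun_prop

@[fun_prop]
theorem continuous_planeWave {d : ℕ} (x : Fin d → ℤ) : Continuous (planeWave x) := by
  unfold planeWave; fun_prop

theorem norm_planeWave {d : ℕ} (x : Fin d → ℤ) (θ : Fin d → ℝ) : ‖planeWave x θ‖ = 1 := by
  unfold planeWave
  rw [norm_prod]
  refine Finset.prod_eq_one fun i _ => ?_
  have := Complex.norm_exp_ofReal_mul_I (x i * θ i)
  push_cast at this
  exact this

theorem planeWave_zero {d : ℕ} (θ : Fin d → ℝ) : planeWave 0 θ = 1 := by
  simp [planeWave]

theorem planeWave_add {d : ℕ} (x y : Fin d → ℤ) (θ : Fin d → ℝ) :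
    planeWave (x + y) θ = planeWave x θ * planeWave y θ := by
  unfold planeWave
  rw [← Finset.prod_mul_distrib]
  refine Finset.prod_congr rfl fun i _ => ?_
  rw [← Complex.exp_add]
  congr 1
  simp only [Pi.add_apply]
  push_cast
  ring

theorem planeWave_single {d : ℕ} (i : Fin d) (a : ℤ) (θ : Fin d → ℝ) :
    planeWave (Pi.single i a) θ = Complex.exp (a * θ i * Complex.I) := by
  unfold planeWave
  rw [Finset.prod_eq_single i]
  · simp
  · intro j _ hj
    simp [hj]
  · simp

theorem symbol_mul_planeWave {d : ℕ} (x : Fin d → ℤ) (θ : Fin d → ℝ) :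
    ∑ i, ((planeWave x θ - planeWave (x + Pi.single i 1) θ) +
      (planeWave x θ - planeWave (x - Pi.single i 1) θ)) = symbol θ * planeWave x θ := by
  unfold symbol
  push_cast
  rw [Finset.sum_mul]
  refine Finset.sum_congr rfl fun i _ => ?_
  rw [sub_eq_add_neg x, ← Pi.single_neg, planeWave_add, planeWave_add, planeWave_single,
    planeWave_single, Complex.cos]
  push_cast
  simp only [one_mul, neg_mul]
  ring

theorem integrable_comp_symbol {d : ℕ} {f : ℝ → ℝ} (hf : Continuous f) (x : Fin d → ℤ) :
    Integrable (fun θ => (f (symbol θ) : ℂ) * planeWave x θ) (torusMeasure d) := by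
  obtain ⟨C, hC⟩ := (isCompact_Icc (a := (0 : ℝ)) (b := 4 * d)).exists_bound_of_continuousOn
    hf.continuousOn
  refine Integrable.of_bound (C := C) ?_ (ae_of_all _ fun θ => ?_)
  · exact Continuous.aestronglyMeasurable (by fun_prop)
  · rw [norm_mul, norm_planeWave, mul_one, Complex.norm_real]
    exact hC _ ⟨symbol_nonneg θ, symbol_le θ⟩

theorem integral_exp_int_angleMeasure (k : ℤ) :
    ∫ θ, Complex.exp (k * θ * Complex.I) ∂angleMeasure = if k = 0 then 1 else 0 := by
  split_ifs with hk
  · simp [hk]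
  · rw [integral_angleMeasure]
    have hk' : (k : ℂ) * Complex.I ≠ 0 := by simp [hk]
    have h := integral_exp_mul_complex (a := -Real.pi) (b := Real.pi) hk'
    have e : ∀ θ : ℝ, (k : ℂ) * θ * Complex.I = k * Complex.I * θ := fun θ => by ring
    simp only [e]
    rw [h]
    have : Complex.exp (k * Complex.I * (Real.pi : ℝ)) =
        Complex.exp (k * Complex.I * (-Real.pi : ℝ)) := by
      rw [Complex.exp_eq_exp_iff_exists_int]
      exact ⟨k, by push_cast; ring⟩
    rw [this, sub_self, zero_div, smul_zero]

theorem integral_planeWave {d : ℕ} (x : Fin d → ℤ) :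
    ∫ θ, planeWave x θ ∂torusMeasure d = if x = 0 then 1 else 0 := by
  unfold planeWave torusMeasure
  rw [integral_fintype_prod_eq_prod (fun i (θ : ℝ) => Complex.exp (x i * θ * Complex.I))]
  simp only [integral_exp_int_angleMeasure]
  split_ifs with h
  · simp [h]
  · obtain ⟨i, hi⟩ := Function.ne_iff.1 h
    exact Finset.prod_eq_zero (Finset.mem_univ i) (if_neg hi)

/-! ### Matrix elements of functions of the Laplacian -/

theorem matrixElement_eq_apply {d : ℕ} (A : L2 d →L[ℂ] L2 d) (n m : Fin d → ℤ) :
    matrixElement A n m = A (delta m) n := by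
  unfold matrixElement
  conv_lhs => rw [delta, lp.inner_single_left]
  simp

theorem norm_delta {d : ℕ} (n : Fin d → ℤ) : ‖delta n‖ = 1 := by
  unfold delta
  rw [lp.norm_single (by norm_num)]
  simp

theorem norm_matrixElement_le {d : ℕ} (A : L2 d →L[ℂ] L2 d) (n m : Fin d → ℤ) :
    ‖matrixElement A n m‖ ≤ ‖A‖ := by
  calc ‖matrixElement A n m‖ ≤ ‖delta n‖ * ‖A (delta m)‖ := norm_inner_le_norm _ _
    _ ≤ ‖delta n‖ * (‖A‖ * ‖delta m‖) := by gcongr; exact A.le_opNorm _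
    _ = ‖A‖ := by simp [norm_delta]

/-- In Fourier variables `-Δ` multiplies by its symbol. -/
theorem negLaplacian_apply_of_eq_integral {d : ℕ} {f : ℝ → ℝ} (hf : Continuous f)
    (m : Fin d → ℤ) {ψ : L2 d}
    (hψ : ∀ n, ψ n = ∫ θ, (f (symbol θ) : ℂ) * planeWave (n - m) θ ∂torusMeasure d)
    (n : Fin d → ℤ) :
    negLaplacian d ψ n =
      ∫ θ, ((symbol θ * f (symbol θ) : ℝ) : ℂ) * planeWave (n - m) θ ∂torusMeasure d := by
  change negLaplacianFun ψ n = _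
  have hi := fun x => integrable_comp_symbol (d := d) hf x
  rw [negLaplacianFun_eq]
  simp only [hψ]
  simp only [← integral_sub (hi _) (hi _)]
  have hadd : ∀ i, Integrable (fun θ => ((f (symbol θ) : ℂ) * planeWave (n - m) θ -
          (f (symbol θ) : ℂ) * planeWave (n + Pi.single i 1 - m) θ) +
        ((f (symbol θ) : ℂ) * planeWave (n - m) θ -
          (f (symbol θ) : ℂ) * planeWave (n - Pi.single i 1 - m) θ)) (torusMeasure d) :=
    fun i => ((hi _).sub (hi _)).add ((hi _).sub (hi _))
  have key := fun i : Fin d => integral_add ((hi (n - m)).sub (hi (n + Pi.single i 1 - m)))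
    ((hi (n - m)).sub (hi (n - Pi.single i 1 - m)))
  simp only [Pi.sub_apply] at key
  simp only [← key]
  rw [← integral_finsetSum _ fun i _ => hadd i]
  refine integral_congr_ae (ae_of_all _ fun θ => ?_)
  have h := symbol_mul_planeWave (n - m) θ
  push_cast
  rw [mul_assoc, mul_left_comm, ← h, Finset.mul_sum]
  refine Finset.sum_congr rfl fun i _ => ?_
  rw [show n + Pi.single i 1 - m = n - m + Pi.single i 1 by abel,
    show n - Pi.single i 1 - m = n - m - Pi.single i 1 by abel]
  ring

theorem negLaplacian_pow_apply {d : ℕ} (k : ℕ) (n m : Fin d → ℤ) :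
    (negLaplacian d ^ k) (delta m) n =
      ∫ θ, ((symbol θ ^ k : ℝ) : ℂ) * planeWave (n - m) θ ∂torusMeasure d := by
  induction k generalizing n with
  | zero =>
    simp only [pow_zero, Complex.ofReal_one, one_mul, integral_planeWave]
    simp only [sub_eq_zero]
    change delta m n = _
    unfold delta
    rw [lp.single_apply]
    split_ifs with h
    · subst h; simp
    · simp [h]
  | succ k ih =>
    rw [pow_succ', mul_apply_eq_comp]
    simpa only [pow_succ'] using
      negLaplacian_apply_of_eq_integral (f := fun y => y ^ k) (by fun_prop) m ih n

theorem matrixElement_add {d : ℕ} (A B : L2 d →L[ℂ] L2 d) (n m : Fin d → ℤ) :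
    matrixElement (A + B) n m = matrixElement A n m + matrixElement B n m := by
  simp [matrixElement]

theorem matrixElement_sub {d : ℕ} (A B : L2 d →L[ℂ] L2 d) (n m : Fin d → ℤ) :
    matrixElement (A - B) n m = matrixElement A n m - matrixElement B n m := by
  simp [matrixElement]

theorem matrixElement_aeval {d : ℕ} (p : Polynomial ℝ) (n m : Fin d → ℤ) :
    matrixElement (Polynomial.aeval (negLaplacian d) p) n m =
      ∫ θ, ((p.eval (symbol θ) : ℝ) : ℂ) * planeWave (n - m) θ ∂torusMeasure d := by
  induction p using Polynomial.induction_on' with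
  | add p q hp hq =>
    rw [map_add, matrixElement_add, hp, hq,
      ← integral_add (integrable_comp_symbol p.continuous _)
        (integrable_comp_symbol q.continuous _)]
    simp [add_mul]
  | monomial k a =>
    rw [Polynomial.aeval_monomial, matrixElement_eq_apply]
    have : (algebraMap ℝ (L2 d →L[ℂ] L2 d) a * negLaplacian d ^ k) (delta m) n =
        (a : ℂ) * (negLaplacian d ^ k) (delta m) n := by
      rw [Algebra.algebraMap_eq_smul_one, smul_one_mul]
      rfl
    rw [this, negLaplacian_pow_apply, ← integral_const_mul]
    simp [mul_assoc]

/-- Stated for a general Hilbert space, where instance search finds the continuous functional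
calculus over `ℝ`; it fails to do so on `L2 d`. -/
theorem norm_operatorPow_sub_aeval_le {H : Type*} [NormedAddCommGroup H] [InnerProductSpace ℂ H]
    [CompleteSpace H] {A : H →L[ℂ] H} (hA : 0 ≤ A) {α : ℝ} (hα : 0 < α) {R ε : ℝ} (hR : ‖A‖ ≤ R)
    (hε : 0 ≤ ε) {p : Polynomial ℝ} (hp : ∀ x ∈ Icc (-R) R, |p.eval x - x ^ α| ≤ ε) :
    ‖operatorPow A α - Polynomial.aeval A p‖ ≤ ε := by
  have hsa : IsSelfAdjoint A := IsSelfAdjoint.of_nonneg hA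
  rcases subsingleton_or_nontrivial H with h | h
  · rw [Subsingleton.elim (operatorPow A α - Polynomial.aeval A p) 0, norm_zero]
    exact hε
  unfold operatorPow
  rw [CFC.rpow_eq_cfc_real hA, ← cfc_polynomial p A hsa,
    ← cfc_sub (fun x : ℝ => x ^ α) (fun x => p.eval x) A
      (Real.continuous_rpow_const hα.le).continuousOn p.continuous.continuousOn]
  refine norm_cfc_le hε fun x hx => ?_
  rw [norm_sub_rev]
  have hx' : |x| ≤ R := (spectrum.norm_le_norm_of_mem hx).trans hR
  exact hp x (abs_le.1 hx')

/-- The spectral theorem for the powers of `-Δ` on matrix elements: by Weierstrass approximation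
it suffices to check it on polynomials. -/
theorem matrixElement_fracLaplacian {d : ℕ} {α : ℝ} (hα : 0 < α) (n m : Fin d → ℤ) :
    matrixElement (fracLaplacian d α) n m =
      ∫ θ, ((symbol θ ^ α : ℝ) : ℂ) * planeWave (n - m) θ ∂torusMeasure d := by
  have hf : Continuous fun x : ℝ => x ^ α := Real.continuous_rpow_const hα.le
  rw [← sub_eq_zero, ← norm_le_zero_iff]
  refine le_of_forall_pos_le_add fun ε hε => ?_
  rw [zero_add]
  set R : ℝ := max ‖negLaplacian d‖ (4 * d)
  obtain ⟨p, hp⟩ := exists_polynomial_near_of_continuousOn (-R) R _ hf.continuousOn (ε / 2)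
    (by positivity)
  have h1 : ‖fracLaplacian d α - Polynomial.aeval (negLaplacian d) p‖ ≤ ε / 2 :=
    norm_operatorPow_sub_aeval_le (negLaplacian_nonneg d) hα (le_max_left _ _) (by positivity)
      fun x hx => (hp x hx).le
  have h2 : ‖(∫ θ, ((p.eval (symbol θ) : ℝ) : ℂ) * planeWave (n - m) θ ∂torusMeasure d) -
      ∫ θ, ((symbol θ ^ α : ℝ) : ℂ) * planeWave (n - m) θ ∂torusMeasure d‖ ≤ ε / 2 := by
    rw [← integral_sub (integrable_comp_symbol p.continuous _) (integrable_comp_symbol hf _)]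
    refine (norm_integral_le_of_norm_le_const (C := ε / 2) (ae_of_all _ fun θ => ?_)).trans ?_
    · rw [← sub_mul, norm_mul, norm_planeWave, mul_one, ← Complex.ofReal_sub, Complex.norm_real]
      have hR : symbol θ ≤ R := (symbol_le θ).trans (le_max_right _ _)
      have h0 := symbol_nonneg θ
      exact (hp _ ⟨by linarith, hR⟩).le
    · simp
  calc ‖matrixElement (fracLaplacian d α) n m - _‖
      = ‖matrixElement (fracLaplacian d α - Polynomial.aeval (negLaplacian d) p) n m +
        ((∫ θ, ((p.eval (symbol θ) : ℝ) : ℂ) * planeWave (n - m) θ ∂torusMeasure d) -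
      ∫ θ, ((symbol θ ^ α : ℝ) : ℂ) * planeWave (n - m) θ ∂torusMeasure d)‖ := by
        rw [matrixElement_sub, matrixElement_aeval]; congr 1; ring
    _ ≤ ε / 2 + ε / 2 :=
        (norm_add_le _ _).trans (add_le_add ((norm_matrixElement_le _ _ _).trans h1) h2)
    _ = ε := by ring


/-! ### Powers as superpositions of exponentials -/

theorem integrableOn_min_mul_rpow {α : ℝ} (hα0 : 0 < α) (hα1 : α < 1) :
    IntegrableOn (fun t : ℝ => min t 1 * t ^ (-1 - α)) (Ioi 0) := by
  rw [← Ioc_union_Ioi_eq_Ioi (zero_le_one' ℝ)]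
  refine IntegrableOn.union ?_ ?_
  · have h : IntegrableOn (fun t : ℝ => t ^ (-α)) (Ioc 0 1) :=
      (intervalIntegrable_iff_integrableOn_Ioc_of_le zero_le_one).1
        (intervalIntegral.intervalIntegrable_rpow' (by linarith))
    refine h.congr_fun (fun t ht => ?_) measurableSet_Ioc
    simp only
    rw [min_eq_left ht.2, ← Real.rpow_one_add' ht.1.le (by linarith)]
    congr 1
    ring
  · have h : IntegrableOn (fun t : ℝ => t ^ (-1 - α)) (Ioi 1) :=
      integrableOn_Ioi_rpow_of_lt (by linarith) one_pos
    refine h.congr_fun (fun t ht => ?_) measurableSet_Ioi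
    simp only
    rw [min_eq_right (le_of_lt ht), one_mul]

theorem abs_one_sub_exp_le {t y c : ℝ} (ht : 0 ≤ t) (hy : 0 ≤ y) (hyc : y ≤ c) (hc : 1 ≤ c) :
    |1 - Real.exp (-(t * y))| ≤ c * min t 1 := by
  have h1 : Real.exp (-(t * y)) ≤ 1 := Real.exp_le_one_iff.2 (by nlinarith)
  have h2 := Real.add_one_le_exp (-(t * y))
  have h3 := Real.exp_pos (-(t * y))
  rw [abs_of_nonneg (by linarith)]
  rcases le_total t 1 with h | h
  · rw [min_eq_left h]
    nlinarith
  · rw [min_eq_right h]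
    linarith

theorem abs_Gamma_neg {α : ℝ} (hα0 : 0 < α) (hα1 : α < 1) :
    |Real.Gamma (-α)| = Real.Gamma (1 - α) / α := by
  have h := Real.Gamma_add_one (neg_ne_zero.2 hα0.ne')
  have hp : 0 < Real.Gamma (1 - α) := Real.Gamma_pos_of_pos (by linarith)
  have e : Real.Gamma (-α) = -(Real.Gamma (1 - α) / α) := by
    rw [show 1 - α = -α + 1 by ring, h]
    field_simp
  rw [e, abs_neg, abs_of_pos (by positivity)]

theorem abs_Gamma_neg_pos {α : ℝ} (hα0 : 0 < α) (hα1 : α < 1) : 0 < |Real.Gamma (-α)| := by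
  rw [abs_Gamma_neg hα0 hα1]
  have := Real.Gamma_pos_of_pos (show 0 < 1 - α by linarith)
  positivity

/-- Integration by parts turns the left-hand side into the integral defining `Γ(1 - α)`. -/
theorem integral_one_sub_exp_mul_rpow {α y : ℝ} (hα0 : 0 < α) (hα1 : α < 1) (hy : 0 ≤ y) :
    ∫ t in Ioi (0 : ℝ), (1 - Real.exp (-(t * y))) * t ^ (-1 - α) =
      |Real.Gamma (-α)| * y ^ α := by
  rcases hy.eq_or_lt with rfl | hy
  · simp [Real.zero_rpow hα0.ne']
  have hu : ∀ t ∈ Ioi (0 : ℝ), HasDerivAt (fun t : ℝ => 1 - Real.exp (-(t * y)))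
      (y * Real.exp (-(y * t))) t := fun t _ => by
    have h := (((hasDerivAt_id t).mul_const y).neg.exp).const_sub 1
    refine HasDerivAt.congr_deriv h ?_
    simp only [id, Pi.neg_apply, mul_comm t y]
    ring
  have hv : ∀ t ∈ Ioi (0 : ℝ), HasDerivAt (fun t : ℝ => -t ^ (-α) / α) (t ^ (-1 - α)) t :=
    fun t ht => by
      have h := ((Real.hasDerivAt_rpow_const (x := t) (p := -α)
        (Or.inl (ne_of_gt ht))).neg).div_const α
      refine HasDerivAt.congr_deriv h ?_
      rw [show -α - 1 = -1 - α by ring]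
      field_simp
  have hG : IntegrableOn (fun t : ℝ => t ^ (1 - α - 1) * Real.exp (-(y * t))) (Ioi 0) := by
    have h := Real.integral_rpow_mul_exp_neg_mul_Ioi (a := 1 - α) (by linarith) hy
    -- a non-integrable function has integral `0`, whereas this integral is positive
    by_contra hn
    rw [integral_undef hn] at h
    have hp := Real.Gamma_pos_of_pos (show 0 < 1 - α by linarith)
    have : 0 < (1 / y) ^ (1 - α) * Real.Gamma (1 - α) := by positivity
    linarith
  have hint1 : IntegrableOn ((fun t : ℝ => 1 - Real.exp (-(t * y))) * fun t => t ^ (-1 - α))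
      (Ioi 0) := by
    refine Integrable.mono' ((integrableOn_min_mul_rpow hα0 hα1).const_mul (max y 1)) ?_ ?_
    · exact Measurable.aestronglyMeasurable (by fun_prop)
    · refine (ae_restrict_mem measurableSet_Ioi).mono fun t ht => ?_
      have ht' : (0 : ℝ) < t := ht
      rw [Pi.mul_apply, norm_mul, Real.norm_of_nonneg (Real.rpow_nonneg ht'.le _), ← mul_assoc]
      gcongr
      exact abs_one_sub_exp_le ht'.le hy.le (le_max_left _ _) (le_max_right _ _)
  have e : ∀ t : ℝ, y * Real.exp (-(y * t)) * (-t ^ (-α) / α) =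
      -(y / α) * (t ^ (1 - α - 1) * Real.exp (-(y * t))) := fun t => by
    rw [show 1 - α - 1 = -α by ring]
    ring
  have hint2 : IntegrableOn ((fun t : ℝ => y * Real.exp (-(y * t))) * fun t => -t ^ (-α) / α)
      (Ioi 0) := by
    exact IntegrableOn.congr_fun (hG.const_mul (-(y / α))) (fun t _ => (e t).symm)
      measurableSet_Ioi
  have hlim0 : Tendsto ((fun t : ℝ => 1 - Real.exp (-(t * y))) * fun t => -t ^ (-α) / α)
      (𝓝[>] 0) (𝓝 0) := by
    have h0 : Tendsto (fun t : ℝ => max y 1 / α * t ^ (1 - α)) (𝓝[>] 0) (𝓝 0) := by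
      have := ((Real.continuous_rpow_const (show 0 ≤ 1 - α by linarith)).tendsto 0).const_mul
        (max y 1 / α)
      rw [Real.zero_rpow (by linarith), mul_zero] at this
      exact this.mono_left nhdsWithin_le_nhds
    refine squeeze_zero_norm' ?_ h0
    filter_upwards [self_mem_nhdsWithin] with t ht
    have ht' : (0 : ℝ) < t := ht
    have hb := abs_one_sub_exp_le ht'.le hy.le (le_max_left y 1) (le_max_right y 1)
    rw [Pi.mul_apply, norm_mul, norm_div, norm_neg, Real.norm_of_nonneg (Real.rpow_nonneg ht'.le _),
      Real.norm_of_nonneg hα0.le, sub_eq_add_neg 1 α, Real.rpow_add ht', Real.rpow_one]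
    calc _ ≤ (max y 1 * t) * (t ^ (-α) / α) := by
          gcongr
          exact hb.trans (by gcongr; exact min_le_left _ _)
      _ = _ := by ring
  have hlim1 : Tendsto ((fun t : ℝ => 1 - Real.exp (-(t * y))) * fun t => -t ^ (-α) / α)
      atTop (𝓝 0) := by
    have h1 : Tendsto (fun t : ℝ => 1 - Real.exp (-(t * y))) atTop (𝓝 (1 - 0)) :=
      (Real.tendsto_exp_neg_atTop_nhds_zero.comp (tendsto_id.atTop_mul_const hy)).const_sub 1
    have h2 : Tendsto (fun t : ℝ => -t ^ (-α) / α) atTop (𝓝 (-0 / α)) :=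
      ((tendsto_rpow_neg_atTop hα0).neg).div_const α
    have := h1.mul h2
    rw [neg_zero, zero_div, mul_zero] at this
    exact this
  rw [integral_Ioi_mul_deriv_eq_deriv_mul hu hv hint1 hint2 hlim0 hlim1]
  simp only [e]
  rw [integral_const_mul, Real.integral_rpow_mul_exp_neg_mul_Ioi (by linarith) hy,
    abs_Gamma_neg hα0 hα1, one_div, Real.inv_rpow hy.le, Real.rpow_sub hy, Real.rpow_one]
  have : y ^ α ≠ 0 := (Real.rpow_pos_of_pos hy α).ne'
  field_simp
  ring

/-! ### Subordination to the heat kernel -/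

/-- The heat kernel `⟨δ_k, e^{tΔ} δ_0⟩` of `ℤ`, given by its Fourier representation; it equals
`e^{-2t} I_k(2t)` with the modified Bessel function `I_k`. -/
noncomputable def latticeHeat (t : ℝ) (k : ℤ) : ℂ :=
  ∫ θ, Complex.exp (-(t * (2 * (1 - Real.cos θ)) : ℝ)) * Complex.exp (k * θ * Complex.I)
    ∂angleMeasure

theorem integral_exp_symbol {d : ℕ} (t : ℝ) (x : Fin d → ℤ) :
    ∫ θ, (Real.exp (-(t * symbol θ)) : ℂ) * planeWave x θ ∂torusMeasure d =
      ∏ i, latticeHeat t (x i) := by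
  unfold latticeHeat torusMeasure
  rw [← integral_fintype_prod_eq_prod (fun i (θ : ℝ) =>
    Complex.exp (-(t * (2 * (1 - Real.cos θ)) : ℝ)) * Complex.exp (x i * θ * Complex.I))]
  refine integral_congr_ae (ae_of_all _ fun θ => ?_)
  simp only
  rw [Finset.prod_mul_distrib, ← Complex.exp_sum, planeWave, symbol, Finset.mul_sum]
  push_cast
  rw [Finset.sum_neg_distrib]

theorem integrable_subordination {d : ℕ} {α : ℝ} (hα0 : 0 < α) (hα1 : α < 1)
    (x : Fin d → ℤ) :
    Integrable (Function.uncurry fun (θ : Fin d → ℝ) (t : ℝ) =>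
      (((1 - Real.exp (-(t * symbol θ))) * t ^ (-1 - α) : ℝ) : ℂ) * planeWave x θ)
      ((torusMeasure d).prod (volume.restrict (Ioi 0))) := by
  have hb : Integrable (fun z : (Fin d → ℝ) × ℝ => (4 * d + 1 : ℝ) *
      (min z.2 1 * z.2 ^ (-1 - α))) ((torusMeasure d).prod (volume.restrict (Ioi 0))) :=
    (integrable_const (4 * d + 1 : ℝ)).mul_prod (integrableOn_min_mul_rpow hα0 hα1)
  refine hb.mono' ?_ ?_
  · refine Measurable.aestronglyMeasurable ?_
    unfold Function.uncurry
    have h1 : Measurable fun z : (Fin d → ℝ) × ℝ => symbol z.1 :=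
      continuous_symbol.measurable.comp measurable_fst
    have h2 : Measurable fun z : (Fin d → ℝ) × ℝ => planeWave x z.1 :=
      (continuous_planeWave x).measurable.comp measurable_fst
    fun_prop
  · have hpos : ∀ᵐ z ∂(torusMeasure d).prod (volume.restrict (Ioi (0 : ℝ))), z.2 ∈ Ioi (0 : ℝ) :=
      Measure.quasiMeasurePreserving_snd.ae (ae_restrict_mem measurableSet_Ioi)
    filter_upwards [hpos] with z hz
    have hz' : 0 < z.2 := hz
    rw [Function.uncurry, norm_mul, norm_planeWave, mul_one, Complex.norm_real, norm_mul,
      Real.norm_of_nonneg (Real.rpow_nonneg hz'.le _), ← mul_assoc]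
    gcongr
    exact abs_one_sub_exp_le hz'.le (symbol_nonneg _) ((symbol_le _).trans (by linarith))
      (by linarith [Nat.cast_nonneg (α := ℝ) d])

/-- Off the diagonal, the matrix elements of `-(-Δ)^α` are an average of the heat kernel over all
times. -/
theorem neg_matrixElement_fracLaplacian {d : ℕ} {α : ℝ} (hα0 : 0 < α) (hα1 : α < 1)
    {n m : Fin d → ℤ} (hnm : n ≠ m) :
    -matrixElement (fracLaplacian d α) n m = (|Real.Gamma (-α)|⁻¹ : ℝ) *
      ∫ t in Ioi (0 : ℝ), ((t ^ (-1 - α) : ℝ) : ℂ) * ∏ i, latticeHeat t ((n - m) i) := by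
  have hΓ := abs_Gamma_neg_pos hα0 hα1
  have h1 : ∀ θ : Fin d → ℝ, ((symbol θ ^ α : ℝ) : ℂ) * planeWave (n - m) θ =
      (|Real.Gamma (-α)|⁻¹ : ℝ) * ∫ t in Ioi (0 : ℝ),
        (((1 - Real.exp (-(t * symbol θ))) * t ^ (-1 - α) : ℝ) : ℂ) * planeWave (n - m) θ := by
    intro θ
    rw [integral_mul_const, integral_complex_ofReal,
      integral_one_sub_exp_mul_rpow hα0 hα1 (symbol_nonneg θ), ← mul_assoc, ← Complex.ofReal_mul,
      inv_mul_cancel_left₀ hΓ.ne']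
  rw [matrixElement_fracLaplacian hα0]
  simp only [h1]
  rw [integral_const_mul, integral_integral_swap (integrable_subordination hα0 hα1 _),
    ← mul_neg, ← integral_neg]
  congr 1
  refine integral_congr_ae (ae_of_all _ fun t => ?_)
  simp only
  have e : ∀ θ : Fin d → ℝ,
      (((1 - Real.exp (-(t * symbol θ))) * t ^ (-1 - α) : ℝ) : ℂ) * planeWave (n - m) θ =
      ((t ^ (-1 - α) : ℝ) : ℂ) * (planeWave (n - m) θ -
        (Real.exp (-(t * symbol θ)) : ℂ) * planeWave (n - m) θ) := fun θ => by
    push_cast; ring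
  simp only [e]
  have hi1 : Integrable (planeWave (n - m)) (torusMeasure d) := by
    simpa using integrable_comp_symbol (f := fun _ => 1) continuous_const (n - m)
  have hi2 := integrable_comp_symbol (d := d) (f := fun y => Real.exp (-(t * y))) (by fun_prop)
    (n - m)
  rw [integral_const_mul, integral_sub hi1 hi2, integral_planeWave,
    if_neg (sub_ne_zero.2 hnm), integral_exp_symbol]
  ring

theorem matrixElement_fracLaplacian_diag {d : ℕ} {α : ℝ} (hα0 : 0 < α) (n : Fin d → ℤ) :
    matrixElement (fracLaplacian d α) n n = (∫ θ : Fin d → ℝ, symbol θ ^ α ∂torusMeasure d : ℝ) := by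
  rw [matrixElement_fracLaplacian hα0, ← integral_complex_ofReal]
  simp [planeWave_zero]


/-! ### Positivity of the heat kernel -/

/-- The number of nearest-neighbour walks of length `j` on `ℤ` from `0` to `k`. -/
def walkCount : ℕ → ℤ → ℕ
  | 0, k => if k = 0 then 1 else 0
  | j + 1, k => walkCount j (k + 1) + walkCount j (k - 1)

theorem walkCount_natAbs_pos (k : ℤ) : 0 < walkCount k.natAbs k := by
  suffices ∀ (j : ℕ) (k : ℤ), k.natAbs = j → 0 < walkCount j k from this _ k rfl
  intro j
  induction j with
  | zero =>
    intro k hk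
    simp [walkCount, Int.natAbs_eq_zero.1 hk]
  | succ j ih =>
    intro k hk
    rcases lt_or_ge k 0 with h | h
    · have := ih (k + 1) (by omega)
      simp only [walkCount]
      omega
    · have := ih (k - 1) (by omega)
      simp only [walkCount]
      omega

theorem integrable_angleMeasure_of_continuous {f : ℝ → ℂ} (hf : Continuous f) :
    Integrable f angleMeasure := by
  unfold angleMeasure
  refine Integrable.smul_measure ?_ ENNReal.ofReal_ne_top
  exact (hf.integrableOn_Icc).mono_set Ioc_subset_Icc_self

theorem integral_two_cos_pow (j : ℕ) (k : ℤ) :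
    ∫ θ : ℝ, ((2 * Real.cos θ : ℝ) : ℂ) ^ j * Complex.exp (k * θ * Complex.I) ∂angleMeasure =
      walkCount j k := by
  induction j generalizing k with
  | zero =>
    simp only [pow_zero, one_mul, integral_exp_int_angleMeasure, walkCount]
    split_ifs <;> simp
  | succ j ih =>
    rw [walkCount, Nat.cast_add, ← ih, ← ih, ← integral_add]
    · refine integral_congr_ae (ae_of_all _ fun θ => ?_)
      have h1 : Complex.exp (((k + 1 : ℤ) : ℂ) * θ * Complex.I) =
          Complex.exp (k * θ * Complex.I) * Complex.exp (θ * Complex.I) := by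
        rw [← Complex.exp_add]; congr 1; push_cast; ring
      have h2 : Complex.exp (((k - 1 : ℤ) : ℂ) * θ * Complex.I) =
          Complex.exp (k * θ * Complex.I) * Complex.exp (-θ * Complex.I) := by
        rw [← Complex.exp_add]; congr 1; push_cast; ring
      simp only [h1, h2, pow_succ]
      push_cast
      rw [Complex.cos]
      ring
    · exact integrable_angleMeasure_of_continuous (by fun_prop)
    · exact integrable_angleMeasure_of_continuous (by fun_prop)

/-- The heat kernel as a Poisson mixture of walk counts. -/
theorem hasSum_latticeHeat (t : ℝ) (k : ℤ) :
    HasSum (fun j : ℕ => ((Real.exp (-(2 * t)) * (t ^ j / j.factorial * walkCount j k) : ℝ) : ℂ))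
      (latticeHeat t k) := by
  let F : ℕ → ℝ → ℂ := fun j θ => ((Real.exp (-(2 * t)) * (t ^ j / j.factorial) : ℝ) : ℂ) *
    (((2 * Real.cos θ : ℝ) : ℂ) ^ j * Complex.exp (k * θ * Complex.I))
  have hF : ∀ j, Integrable (F j) angleMeasure := fun j =>
    integrable_angleMeasure_of_continuous (by fun_prop)
  have hbound : ∀ j θ, ‖F j θ‖ ≤ Real.exp (-(2 * t)) * ((2 * |t|) ^ j / j.factorial) := by
    intro j θ
    have hw : ‖Complex.exp (k * θ * Complex.I)‖ = 1 := by
      have := Complex.norm_exp_ofReal_mul_I (k * θ)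
      push_cast at this
      exact this
    have hc : |2 * Real.cos θ| ≤ 2 := by
      rw [abs_mul, abs_two]; linarith [Real.abs_cos_le_one θ]
    simp only [F]
    rw [norm_mul, norm_mul, hw, mul_one, norm_pow, Complex.norm_real, Complex.norm_real, norm_mul,
      norm_div, norm_pow, Real.norm_of_nonneg (Real.exp_pos _).le, RCLike.norm_natCast,
      Real.norm_eq_abs, Real.norm_eq_abs, mul_pow]
    calc _ ≤ Real.exp (-(2 * t)) * (|t| ^ j / j.factorial) * 2 ^ j := by gcongr
      _ = _ := by ring
  have hsum : Summable fun j => ∫ θ, ‖F j θ‖ ∂angleMeasure := by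
    refine Summable.of_nonneg_of_le (fun j => integral_nonneg fun θ => norm_nonneg _) (fun j => ?_)
      ((Real.summable_pow_div_factorial (2 * |t|)).mul_left (Real.exp (-(2 * t))))
    calc ∫ θ, ‖F j θ‖ ∂angleMeasure
        ≤ ∫ _θ, Real.exp (-(2 * t)) * ((2 * |t|) ^ j / j.factorial) ∂angleMeasure :=
          integral_mono (hF j).norm (integrable_const _) (hbound j)
      _ = _ := by simp
  have h := hasSum_integral_of_summable_integral_norm hF hsum
  have e1 : ∀ j, ∫ θ, F j θ ∂angleMeasure =
      ((Real.exp (-(2 * t)) * (t ^ j / j.factorial * walkCount j k) : ℝ) : ℂ) := by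
    intro j
    simp only [F]
    rw [integral_const_mul, integral_two_cos_pow]
    push_cast
    ring
  have e2 : ∫ θ, ∑' j, F j θ ∂angleMeasure = latticeHeat t k := by
    unfold latticeHeat
    refine integral_congr_ae (ae_of_all _ fun θ => ?_)
    have h1 := (NormedSpace.expSeries_div_hasSum_exp ((t * (2 * Real.cos θ) : ℝ) : ℂ)).mul_left
      ((Real.exp (-(2 * t)) : ℝ) : ℂ)
    rw [← Complex.exp_eq_exp_ℂ] at h1
    have h2 := h1.mul_right (Complex.exp (k * θ * Complex.I))
    have e3 : ∀ j, F j θ = ((Real.exp (-(2 * t)) : ℝ) : ℂ) *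
        (((t * (2 * Real.cos θ) : ℝ) : ℂ) ^ j / j.factorial) *
        Complex.exp (k * θ * Complex.I) := fun j => by
      simp only [F]
      push_cast
      ring
    simp only [e3]
    rw [h2.tsum_eq, Complex.ofReal_exp, ← Complex.exp_add]
    congr 2
    push_cast
    ring
  simpa only [e1, e2] using h

theorem ofReal_re_latticeHeat (t : ℝ) (k : ℤ) : ((latticeHeat t k).re : ℂ) = latticeHeat t k := by
  have h := hasSum_latticeHeat t k
  have h2 := Complex.hasSum_ofReal.2 ((Complex.hasSum_re h))
  simp only [Complex.ofReal_re] at h2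
  exact h2.unique h

theorem re_latticeHeat_pos {t : ℝ} (ht : 0 < t) (k : ℤ) : 0 < (latticeHeat t k).re := by
  have h := Complex.hasSum_re (hasSum_latticeHeat t k)
  simp only [Complex.ofReal_re] at h
  have hpos : 0 < Real.exp (-(2 * t)) *
      (t ^ k.natAbs / k.natAbs.factorial * walkCount k.natAbs k) := by
    have := walkCount_natAbs_pos k
    positivity
  exact hpos.trans_le (le_hasSum h k.natAbs fun j _ => by positivity)

/-! ### Decay of the heat kernel -/

/-- The return probability `⟨δ_0, e^{tΔ} δ_0⟩` on `ℤ`. -/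
noncomputable def returnProb (t : ℝ) : ℝ :=
  ∫ θ, Real.exp (-(t * (2 * (1 - Real.cos θ)))) ∂angleMeasure

theorem returnProb_nonneg (t : ℝ) : 0 ≤ returnProb t :=
  integral_nonneg fun _ => (Real.exp_pos _).le

theorem returnProb_le_one {t : ℝ} (ht : 0 ≤ t) : returnProb t ≤ 1 := by
  have : ∀ θ : ℝ, ‖Real.exp (-(t * (2 * (1 - Real.cos θ))))‖ ≤ 1 := fun θ => by
    rw [Real.norm_of_nonneg (Real.exp_pos _).le, Real.exp_le_one_iff, neg_nonpos]
    have := Real.cos_le_one θ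
    exact mul_nonneg ht (by linarith)
  have h := norm_integral_le_of_norm_le_const (μ := angleMeasure) (ae_of_all _ this)
  simp only [probReal_univ, mul_one] at h
  exact (le_abs_self _).trans h

/-- On `[-π, π]` the symbol dominates a parabola, and the kernel a Gaussian. -/
theorem exp_neg_symbol_le {t θ : ℝ} (ht : 0 ≤ t) (hθ : |θ| ≤ Real.pi) :
    Real.exp (-(t * (2 * (1 - Real.cos θ)))) ≤ Real.exp (-(4 * t / Real.pi ^ 2) * θ ^ 2) := by
  rw [Real.exp_le_exp]
  have h := Real.cos_le_one_sub_mul_cos_sq hθ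
  have := mul_le_mul_of_nonneg_left h ht
  have e : 4 * t / Real.pi ^ 2 * θ ^ 2 = 2 * (t * (2 / Real.pi ^ 2 * θ ^ 2)) := by ring
  nlinarith

theorem sqrt_mul_returnProb_le {t : ℝ} (ht : 0 < t) : √t * returnProb t ≤ 1 := by
  have hπ := Real.pi_pos
  have hb : 0 < 4 * t / Real.pi ^ 2 := by positivity
  have h1 : returnProb t ≤ (2 * Real.pi)⁻¹ * √(Real.pi / (4 * t / Real.pi ^ 2)) := by
    rw [returnProb, integral_angleMeasure, smul_eq_mul,
      intervalIntegral.integral_of_le (by linarith), ← integral_gaussian]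
    gcongr
    calc _ ≤ ∫ θ in Ioc (-Real.pi) Real.pi, Real.exp (-(4 * t / Real.pi ^ 2) * θ ^ 2) := by
          refine setIntegral_mono_on ?_ (integrable_exp_neg_mul_sq hb).integrableOn
            measurableSet_Ioc fun θ hθ => exp_neg_symbol_le ht.le (abs_le.2 ⟨hθ.1.le, hθ.2⟩)
          exact (Continuous.integrableOn_Icc (by fun_prop)).mono_set Ioc_subset_Icc_self
      _ ≤ _ := setIntegral_le_integral (integrable_exp_neg_mul_sq hb)
          (ae_of_all _ fun θ => (Real.exp_pos _).le)
  have h2 : √(Real.pi / (4 * t / Real.pi ^ 2)) ≤ 2 * Real.pi / √t := by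
    rw [Real.sqrt_le_left (by positivity), div_pow, mul_pow, Real.sq_sqrt ht.le]
    rw [show Real.pi / (4 * t / Real.pi ^ 2) = Real.pi ^ 2 * (Real.pi / 4) / t by field_simp]
    have : Real.pi ^ 2 * (Real.pi / 4) ≤ 2 ^ 2 * Real.pi ^ 2 := by
      nlinarith [Real.pi_le_four, sq_nonneg Real.pi]
    gcongr
  have hs : 0 < √t := Real.sqrt_pos.2 ht
  calc √t * returnProb t ≤ √t * ((2 * Real.pi)⁻¹ * (2 * Real.pi / √t)) := by
        gcongr
        exact h1.trans (by gcongr)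
    _ = 1 := by field_simp

theorem integral_angleMeasure_of_periodic {E : Type*} [NormedAddCommGroup E] [NormedSpace ℝ E]
    {f : ℝ → E} (hf : Function.Periodic f (2 * Real.pi)) :
    ∫ θ, f θ ∂angleMeasure = (2 * Real.pi)⁻¹ • ∫ θ in (0 : ℝ)..2 * Real.pi, f θ := by
  rw [integral_angleMeasure]
  congr 1
  have := hf.intervalIntegral_add_eq (-Real.pi) 0
  rwa [zero_add, show -Real.pi + 2 * Real.pi = Real.pi by ring] at this

/-- The Laurent polynomial exponential `e^{t (z + 1/z - 2)} z^k`, which restricts to the Fourier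
integrand of the heat kernel on the unit circle. -/
noncomputable def heatIntegrand (t : ℝ) (k : ℤ) (z : ℂ) : ℂ :=
  Complex.exp (t * (z + z⁻¹ - 2)) * z ^ k

theorem differentiableAt_heatIntegrand (t : ℝ) (k : ℤ) {z : ℂ} (hz : z ≠ 0) :
    DifferentiableAt ℂ (heatIntegrand t k) z := by
  unfold heatIntegrand
  have h1 : DifferentiableAt ℂ (fun z : ℂ => z⁻¹) z := differentiableAt_inv hz
  have h2 : DifferentiableAt ℂ (fun z : ℂ => z ^ k) z := differentiableAt_zpow.2 (Or.inl hz)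
  fun_prop

theorem circleIntegral_heatIntegrand (t : ℝ) (k : ℤ) {r R : ℝ} (hr : 0 < r) (hR : 0 < R) :
    (∮ z in C(0, R), (z - 0)⁻¹ • heatIntegrand t k z) =
      ∮ z in C(0, r), (z - 0)⁻¹ • heatIntegrand t k z := by
  wlog h : r ≤ R generalizing r R
  · exact (this hR hr (le_of_not_ge h)).symm
  refine Complex.circleIntegral_sub_center_inv_smul_eq_of_differentiable_on_annulus_off_countable
    hr h countable_empty (fun z hz => ?_) fun z hz => ?_
  · refine (differentiableAt_heatIntegrand t k ?_).continuousAt.continuousWithinAt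
    rintro rfl
    exact hz.2 (Metric.mem_ball_self hr)
  · refine differentiableAt_heatIntegrand t k ?_
    rintro rfl
    exact hz.1.2 (Metric.mem_closedBall_self hr.le)

theorem circleIntegral_inv_smul_eq (f : ℂ → ℂ) {r : ℝ} (hr : 0 < r) :
    (∮ z in C(0, r), (z - 0)⁻¹ • f z) =
      Complex.I * ∫ θ in (0 : ℝ)..2 * Real.pi, f (circleMap 0 r θ) := by
  rw [circleIntegral, ← intervalIntegral.integral_const_mul]
  refine intervalIntegral.integral_congr fun θ _ => ?_
  have : circleMap 0 r θ ≠ 0 := circleMap_ne_center hr.ne'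
  simp only [deriv_circleMap, smul_eq_mul, sub_zero]
  field_simp

theorem latticeHeat_eq_integral_circleMap (t : ℝ) (k : ℤ) {r : ℝ} (hr : 0 < r) :
    latticeHeat t k = ((2 * Real.pi)⁻¹ : ℝ) •
      ∫ θ in (0 : ℝ)..2 * Real.pi, heatIntegrand t k (circleMap 0 r θ) := by
  have h := circleIntegral_heatIntegrand t k hr one_pos
  rw [circleIntegral_inv_smul_eq _ hr, circleIntegral_inv_smul_eq _ one_pos] at h
  rw [← mul_left_cancel₀ Complex.I_ne_zero h]
  have e : ∀ θ : ℝ, Complex.exp (-(t * (2 * (1 - Real.cos θ)) : ℝ)) *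
      Complex.exp (k * θ * Complex.I) = heatIntegrand t k (circleMap 0 1 θ) := by
    intro θ
    unfold heatIntegrand
    rw [circleMap_zero, Complex.ofReal_one, one_mul, ← Complex.exp_neg, ← Complex.exp_int_mul]
    congr 2
    · push_cast
      rw [Complex.cos, neg_mul]
      ring
    · ring
  unfold latticeHeat
  simp only [e]
  exact integral_angleMeasure_of_periodic fun θ => by rw [periodic_circleMap 0 1 θ]

theorem norm_heatIntegrand_le {t : ℝ} (ht : 0 ≤ t) (k : ℤ) {r : ℝ} (hr : 0 < r) (θ : ℝ) :
    ‖heatIntegrand t k (circleMap 0 r θ)‖ ≤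
      r ^ k * Real.exp (t * (r + r⁻¹ - 2)) * Real.exp (-(t * (2 * (1 - Real.cos θ)))) := by
  have hn : ‖circleMap 0 r θ‖ = r := by simp [abs_of_pos hr]
  have hre : (t * (circleMap 0 r θ + (circleMap 0 r θ)⁻¹ - 2) : ℂ).re =
      t * ((r + r⁻¹) * Real.cos θ - 2) := by
    rw [circleMap_zero, mul_inv, ← Complex.exp_neg, ← neg_mul, ← Complex.ofReal_neg,
      ← Complex.ofReal_inv, Complex.re_ofReal_mul, Complex.sub_re, Complex.add_re,
      Complex.re_ofReal_mul, Complex.re_ofReal_mul, Complex.exp_ofReal_mul_I_re,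
      Complex.exp_ofReal_mul_I_re, Real.cos_neg]
    simp
    ring_nf
    simp
  unfold heatIntegrand
  rw [norm_mul, norm_zpow, hn, Complex.norm_exp, hre, mul_comm, mul_assoc, ← Real.exp_add]
  gcongr
  have h2 : 2 ≤ r + r⁻¹ := by
    rw [← sub_nonneg, show r + r⁻¹ - 2 = (r - 1) ^ 2 / r by field_simp; ring]
    positivity
  have hc := Real.cos_le_one θ
  have : 0 ≤ t * ((r + r⁻¹ - 2) * (1 - Real.cos θ)) :=
    mul_nonneg ht (mul_nonneg (by linarith) (by linarith))
  nlinarith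

/-- The exponential (Chernoff-type) bound, from moving the contour to the circle of radius `r`. -/
theorem norm_latticeHeat_le {t : ℝ} (ht : 0 ≤ t) (k : ℤ) {r : ℝ} (hr : 0 < r) :
    ‖latticeHeat t k‖ ≤ r ^ k * Real.exp (t * (r + r⁻¹ - 2)) * returnProb t := by
  have hper : Function.Periodic (fun θ => Real.exp (-(t * (2 * (1 - Real.cos θ)))))
      (2 * Real.pi) := fun θ => by simp only [Real.cos_add_two_pi]
  rw [latticeHeat_eq_integral_circleMap t k hr, returnProb, integral_angleMeasure_of_periodic hper,
    norm_smul, Real.norm_of_nonneg (by positivity), smul_eq_mul, mul_left_comm]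
  gcongr
  rw [← intervalIntegral.integral_const_mul]
  refine intervalIntegral.norm_integral_le_of_norm_le (by positivity)
    (ae_of_all _ fun θ _ => norm_heatIntegrand_le ht k hr θ) ?_
  exact Continuous.intervalIntegrable (by fun_prop) _ _

theorem norm_latticeHeat_le_returnProb {t : ℝ} (ht : 0 ≤ t) (k : ℤ) :
    ‖latticeHeat t k‖ ≤ returnProb t := by
  have h := norm_latticeHeat_le ht k one_pos
  norm_num at h
  exact h

theorem norm_latticeHeat_le_pow_natAbs {t : ℝ} (ht : 0 ≤ t) (k : ℤ) {r : ℝ} (hr : 0 < r) :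
    ‖latticeHeat t k‖ ≤ r ^ k.natAbs * Real.exp (t * (r + r⁻¹ - 2)) * returnProb t := by
  rcases Int.natAbs_eq k with h | h
  · have := norm_latticeHeat_le ht k hr
    rwa [h, zpow_natCast, ← h] at this
  · have := norm_latticeHeat_le ht k (inv_pos.2 hr)
    rwa [inv_inv, h, inv_zpow', neg_neg, zpow_natCast, ← h, add_comm r⁻¹] at this

theorem exp_neg_mul_pow_le {y : ℝ} (hy : 0 ≤ y) (M : ℕ) :
    y ^ M * Real.exp (-y) ≤ M.factorial := by
  have h := Real.pow_div_factorial_le_exp y hy M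
  rw [div_le_iff₀ (by positivity)] at h
  rw [Real.exp_neg, ← div_eq_mul_inv, div_le_iff₀ (Real.exp_pos _), mul_comm]
  exact h

/-- `q_t(k) ≤ C t^{(M-1)/2} |k|^{-M}` for `t ≥ 1`. -/
theorem natAbs_pow_mul_norm_latticeHeat_le_of_one_le {t : ℝ} (ht : 1 ≤ t) (k : ℤ) (M : ℕ) :
    (k.natAbs : ℝ) ^ M * ‖latticeHeat t k‖ * √t ≤ Real.exp 2 * M.factorial * √t ^ M := by
  have ht0 : 0 < t := by linarith
  have hs : 0 < √t := Real.sqrt_pos.2 ht0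
  have hs1 : 1 ≤ √t := Real.one_le_sqrt.2 ht
  have hss : √t * √t = t := Real.mul_self_sqrt ht0.le
  -- the optimal radius for a displacement of order `√t`
  have h := norm_latticeHeat_le_pow_natAbs ht0.le k (Real.exp_pos (-(1 / √t)))
  have hexp : t * (Real.exp (-(1 / √t)) + (Real.exp (-(1 / √t)))⁻¹ - 2) ≤ 2 := by
    rw [← Real.exp_neg, neg_neg]
    have h1 := Real.cosh_le_exp_half_sq (1 / √t)
    rw [Real.cosh_eq, div_pow, Real.sq_sqrt ht0.le, one_pow] at h1
    have h2 : |1 / t / 2| ≤ 1 := by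
      rw [abs_of_pos (by positivity), div_div, div_le_one (by positivity)]; linarith
    have h3 := (le_abs_self _).trans (Real.abs_exp_sub_one_le h2)
    rw [abs_of_pos (by positivity)] at h3
    calc _ ≤ t * (2 * (1 / t)) := by gcongr; linarith
      _ = 2 := by field_simp
  set y : ℝ := k.natAbs / √t with hy
  have hpow : Real.exp (-(1 / √t)) ^ k.natAbs = Real.exp (-y) := by
    rw [← Real.exp_nat_mul, hy]; congr 1; ring
  rw [hpow] at h
  have hk : (k.natAbs : ℝ) = y * √t := by rw [hy]; field_simp
  have hy0 : 0 ≤ y := by positivity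
  have hρ := sqrt_mul_returnProb_le ht0
  have hρ0 := returnProb_nonneg t
  calc (k.natAbs : ℝ) ^ M * ‖latticeHeat t k‖ * √t
      ≤ (y * √t) ^ M * (Real.exp (-y) * Real.exp 2 * returnProb t) * √t := by
        rw [← hk]
        gcongr
        exact h.trans (by gcongr)
    _ = Real.exp 2 * (y ^ M * Real.exp (-y)) * √t ^ M * (√t * returnProb t) := by ring
    _ ≤ Real.exp 2 * M.factorial * √t ^ M * 1 := by
        gcongr
        exact exp_neg_mul_pow_le hy0 M
    _ = _ := mul_one _

/-- For small times the off-diagonal heat kernel gains a factor `t`, as at least one jump is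
needed to leave `0`. -/
theorem natAbs_pow_mul_norm_latticeHeat_le_of_le_one {t : ℝ} (ht0 : 0 < t) (ht : t ≤ 1) {k : ℤ}
    (hk : k ≠ 0) (M : ℕ) :
    (k.natAbs : ℝ) ^ M * ‖latticeHeat t k‖ ≤ Real.exp 4 * M.factorial * t := by
  -- the saddle point for `k ≫ t` lies at radius of order `t`
  have h := norm_latticeHeat_le_pow_natAbs ht0.le k (r := t * Real.exp (-1)) (by positivity)
  have hexp : t * (t * Real.exp (-1) + (t * Real.exp (-1))⁻¹ - 2) ≤ 4 := by
    have e : t * (t * Real.exp (-1) + (t * Real.exp (-1))⁻¹ - 2) =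
        t * t * Real.exp (-1) + Real.exp 1 - 2 * t := by
      rw [Real.exp_neg]; field_simp
    have h1 := Real.exp_one_lt_d9
    have h2 : Real.exp (-1) ≤ 1 := Real.exp_le_one_iff.2 (by norm_num)
    rw [e]
    nlinarith [Real.exp_pos (-1), mul_nonneg ht0.le (sub_nonneg.2 ht), mul_pos ht0 ht0]
  have hpow : (t * Real.exp (-1)) ^ k.natAbs ≤ t * Real.exp (-(k.natAbs : ℝ)) := by
    rw [mul_pow, ← Real.exp_nat_mul, mul_neg_one]
    gcongr
    exact pow_le_of_le_one ht0.le ht (Int.natAbs_ne_zero.2 hk)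
  have hρ := returnProb_le_one ht0.le
  have hρ0 := returnProb_nonneg t
  calc (k.natAbs : ℝ) ^ M * ‖latticeHeat t k‖
      ≤ (k.natAbs : ℝ) ^ M * (t * Real.exp (-(k.natAbs : ℝ)) * Real.exp 4 * 1) := by
        gcongr
        exact h.trans (by gcongr)
    _ = Real.exp 4 * ((k.natAbs : ℝ) ^ M * Real.exp (-(k.natAbs : ℝ))) * t := by ring
    _ ≤ _ := by
        gcongr
        exact exp_neg_mul_pow_le (by positivity) M

/-! ### The local central limit theorem -/

/-- The error in the local central limit theorem is at most the `L¹` distance of the Fourier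
transforms, hence bounded uniformly in the displacement `k`. -/
theorem norm_sqrt_mul_latticeHeat_sub_le {t : ℝ} (ht : 0 < t) (k : ℤ) :
    ‖(√t : ℂ) * latticeHeat t k -
        (((2 * √Real.pi)⁻¹ * Real.exp (-((k : ℝ) ^ 2 / (4 * t))) : ℝ) : ℂ)‖ ≤
      (2 * Real.pi)⁻¹ * ∫ u : ℝ, |(Ioc (-Real.pi) Real.pi).indicator
        (fun θ => Real.exp (-(t * (2 * (1 - Real.cos θ))))) ((√t)⁻¹ * u) -
          Real.exp (-1 * u ^ 2)| := by
  have hs : 0 < √t := Real.sqrt_pos.2 ht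
  have hπ := Real.pi_pos
  set A : ℝ → ℝ := (Ioc (-Real.pi) Real.pi).indicator
    (fun θ => Real.exp (-(t * (2 * (1 - Real.cos θ))))) with hA
  have hAi : Integrable A := by
    rw [hA, integrable_indicator_iff measurableSet_Ioc]
    exact (Continuous.integrableOn_Icc (by fun_prop)).mono_set Ioc_subset_Icc_self
  have hAs : Integrable fun u => A ((√t)⁻¹ * u) := hAi.comp_mul_left' (inv_ne_zero hs.ne')
  have hw : ∀ u : ℝ, ‖Complex.exp (Complex.I * ((k / √t : ℝ) : ℂ) * u)‖ = 1 := fun u => by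
    have := Complex.norm_exp_ofReal_mul_I (k / √t * u)
    rw [← this]
    congr 2
    push_cast
    ring
  have hwc : Continuous fun u : ℝ => Complex.exp (Complex.I * ((k / √t : ℝ) : ℂ) * u) := by
    fun_prop
  have hmul : ∀ {f : ℝ → ℝ}, Integrable f → Integrable fun u : ℝ =>
      Complex.exp (Complex.I * ((k / √t : ℝ) : ℂ) * u) * (f u : ℂ) := fun hf =>
    hf.ofReal.bdd_mul hwc.aestronglyMeasurable (ae_of_all _ fun u => (hw u).le)
  have h1 : (√t : ℂ) * latticeHeat t k = ((2 * Real.pi)⁻¹ : ℝ) * ∫ u : ℝ,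
      Complex.exp (Complex.I * ((k / √t : ℝ) : ℂ) * u) * (A ((√t)⁻¹ * u) : ℂ) := by
    have h := Measure.integral_comp_mul_left
      (fun θ : ℝ => Complex.exp (k * θ * Complex.I) * (A θ : ℂ)) (√t)⁻¹
    rw [inv_inv, abs_of_pos hs] at h
    have e : ∀ u : ℝ, Complex.exp (Complex.I * ((k / √t : ℝ) : ℂ) * u) * (A ((√t)⁻¹ * u) : ℂ) =
        Complex.exp (k * ((√t)⁻¹ * u : ℝ) * Complex.I) * (A ((√t)⁻¹ * u) : ℂ) := fun u => by
      congr 2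
      push_cast
      ring
    simp only [e]
    rw [h, latticeHeat, integral_angleMeasure, intervalIntegral.integral_of_le (by linarith),
      ← integral_indicator measurableSet_Ioc, Complex.real_smul, Complex.real_smul, mul_left_comm]
    congr 2
    refine integral_congr_ae (ae_of_all _ fun θ => ?_)
    simp only [hA, indicator_apply]
    split_ifs
    · push_cast
      ring
    · simp
  have h2 : (((2 * √Real.pi)⁻¹ * Real.exp (-((k : ℝ) ^ 2 / (4 * t))) : ℝ) : ℂ) =
      ((2 * Real.pi)⁻¹ : ℝ) * ∫ u : ℝ, Complex.exp (Complex.I * ((k / √t : ℝ) : ℂ) * u) *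
        (Real.exp (-1 * u ^ 2) : ℂ) := by
    have h := fourierIntegral_gaussian (b := 1) (by simp) ((k / √t : ℝ) : ℂ)
    have e : ∀ u : ℝ, (Real.exp (-1 * u ^ 2) : ℂ) = Complex.exp (-1 * (u : ℂ) ^ 2) := fun u => by
      push_cast; rfl
    simp only [e]
    rw [h]
    have e1 : ((Real.pi : ℂ) / 1) ^ (1 / 2 : ℂ) = (√Real.pi : ℝ) := by
      rw [div_one, Real.sqrt_eq_rpow, Complex.ofReal_cpow hπ.le]
      push_cast
      rfl
    have e2 : -(((k / √t : ℝ) : ℂ)) ^ 2 / (4 * 1) = ((-((k : ℝ) ^ 2 / (4 * t)) : ℝ) : ℂ) := by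
      rw [← Complex.ofReal_pow, div_pow, Real.sq_sqrt ht.le]
      push_cast
      ring
    rw [e1, e2, ← Complex.ofReal_exp, ← Complex.ofReal_mul, ← Complex.ofReal_mul]
    congr 1
    rw [← mul_assoc]
    congr 1
    have : √Real.pi ≠ 0 := (Real.sqrt_pos.2 hπ).ne'
    field_simp
    exact (Real.sq_sqrt hπ.le).symm
  have hg : Integrable fun u : ℝ => Real.exp (-1 * u ^ 2) := integrable_exp_neg_mul_sq one_pos
  rw [h1, h2, ← mul_sub, ← integral_sub (hmul hAs) (hmul hg), norm_mul, Complex.norm_real,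
    Real.norm_of_nonneg (by positivity)]
  gcongr
  refine (norm_integral_le_integral_norm _).trans (le_of_eq ?_)
  refine integral_congr_ae (ae_of_all _ fun u => ?_)
  simp only
  rw [← mul_sub, norm_mul, hw, one_mul, ← Complex.ofReal_sub, Complex.norm_real, Real.norm_eq_abs]

theorem tendsto_rescaled_symbol (u : ℝ) :
    Tendsto (fun t : ℝ => t * (2 * (1 - Real.cos ((√t)⁻¹ * u)))) atTop (𝓝 (u ^ 2)) := by
  have h0 : Tendsto (fun t : ℝ => (√t)⁻¹ * u) atTop (𝓝 0) := by
    simpa using (tendsto_inv_atTop_zero.comp Real.tendsto_sqrt_atTop).mul_const u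
  rw [tendsto_iff_norm_sub_tendsto_zero]
  have hb : Tendsto (fun t : ℝ => u ^ 4 * t⁻¹) atTop (𝓝 0) := by
    simpa using tendsto_inv_atTop_zero.const_mul (u ^ 4)
  refine squeeze_zero' (Eventually.of_forall fun t => norm_nonneg _) ?_ hb
  have h1 : ∀ᶠ t : ℝ in atTop, |(√t)⁻¹ * u| ≤ 1 :=
    (h0.abs.eventually (gt_mem_nhds (by simp))).mono fun t ht => le_of_lt ht
  filter_upwards [h1, eventually_gt_atTop 0] with t ht ht0
  have hc := Real.cos_bound ht
  have hs : 0 < √t := Real.sqrt_pos.2 ht0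
  set x := (√t)⁻¹ * u with hx
  have hu : u ^ 2 = t * x ^ 2 := by
    rw [hx, mul_pow, inv_pow, Real.sq_sqrt ht0.le]; field_simp
  have e : t * (2 * (1 - Real.cos x)) - u ^ 2 = -(2 * t) * (Real.cos x - (1 - x ^ 2 / 2)) := by
    rw [hu]; ring
  have e2 : u ^ 4 * t⁻¹ = t * x ^ 4 := by
    rw [show u ^ 4 = (u ^ 2) ^ 2 by ring, hu]; field_simp
  rw [e, e2, norm_mul, norm_neg, Real.norm_of_nonneg (by positivity), Real.norm_eq_abs]
  have h4 : |x| ^ 4 = x ^ 4 := Even.pow_abs (by decide) x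
  rw [h4] at hc
  calc 2 * t * |Real.cos x - (1 - x ^ 2 / 2)| ≤ 2 * t * (x ^ 4 * (5 / 96)) := by gcongr
    _ ≤ t * x ^ 4 := by nlinarith [mul_nonneg ht0.le (by positivity : 0 ≤ x ^ 4)]

theorem tendsto_integral_rescaled_sub_gaussian :
    Tendsto (fun t : ℝ => ∫ u : ℝ, |(Ioc (-Real.pi) Real.pi).indicator
        (fun θ => Real.exp (-(t * (2 * (1 - Real.cos θ))))) ((√t)⁻¹ * u) -
          Real.exp (-1 * u ^ 2)|) atTop (𝓝 0) := by
  have hπ := Real.pi_pos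
  have hb : 0 < 4 / Real.pi ^ 2 := by positivity
  rw [show (0 : ℝ) = ∫ _u : ℝ, (0 : ℝ) by simp]
  refine tendsto_integral_filter_of_dominated_convergence
    (fun u => Real.exp (-(4 / Real.pi ^ 2) * u ^ 2) + Real.exp (-1 * u ^ 2)) ?_ ?_ ?_ ?_
  · refine Eventually.of_forall fun t => Measurable.aestronglyMeasurable ?_
    have hm : Measurable ((Ioc (-Real.pi) Real.pi).indicator
        (fun θ => Real.exp (-(t * (2 * (1 - Real.cos θ)))))) :=
      Measurable.indicator (by fun_prop) measurableSet_Ioc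
    have := hm.comp (measurable_const_mul (√t)⁻¹)
    exact Measurable.abs (this.sub (by fun_prop))
  · filter_upwards [eventually_gt_atTop 0] with t ht
    refine ae_of_all _ fun u => ?_
    have hs : 0 < √t := Real.sqrt_pos.2 ht
    rw [Real.norm_eq_abs, abs_abs, ← Real.norm_eq_abs]
    refine (norm_sub_le _ _).trans ?_
    rw [Real.norm_of_nonneg (Real.exp_pos (-1 * u ^ 2)).le]
    gcongr
    rw [indicator_apply]
    split_ifs with h
    · rw [Real.norm_of_nonneg (Real.exp_pos _).le]
      refine (exp_neg_symbol_le ht.le (abs_le.2 ⟨h.1.le, h.2⟩)).trans (le_of_eq ?_)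
      rw [mul_pow, inv_pow, Real.sq_sqrt ht.le]
      congr 1
      field_simp
    · rw [norm_zero]
      positivity
  · exact (integrable_exp_neg_mul_sq hb).add (integrable_exp_neg_mul_sq one_pos)
  · refine ae_of_all _ fun u => ?_
    have h0 : Tendsto (fun t : ℝ => (√t)⁻¹ * u) atTop (𝓝 0) := by
      simpa using (tendsto_inv_atTop_zero.comp Real.tendsto_sqrt_atTop).mul_const u
    have hmem : ∀ᶠ t : ℝ in atTop, (√t)⁻¹ * u ∈ Ioc (-Real.pi) Real.pi :=
      h0.eventually (Ioc_mem_nhds (by linarith) hπ)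
    have h1 : Tendsto (fun t : ℝ => |Real.exp (-(t * (2 * (1 - Real.cos ((√t)⁻¹ * u))))) -
        Real.exp (-1 * u ^ 2)|) atTop (𝓝 |Real.exp (-u ^ 2) - Real.exp (-1 * u ^ 2)|) :=
      (((Real.continuous_exp.tendsto _).comp (tendsto_rescaled_symbol u).neg).sub_const _).abs
    rw [neg_one_mul, sub_self, abs_zero] at h1
    refine h1.congr' ?_
    filter_upwards [hmem] with t ht
    rw [indicator_of_mem ht, neg_one_mul]


/-! ### The heat kernel on `ℤ^d` -/

theorem euclNorm_sq {d : ℕ} (x : Fin d → ℤ) : euclNorm x ^ 2 = ∑ i, (x i : ℝ) ^ 2 := by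
  unfold euclNorm
  rw [EuclideanSpace.norm_sq_eq]
  simp

theorem euclNorm_nonneg {d : ℕ} (x : Fin d → ℤ) : 0 ≤ euclNorm x := norm_nonneg _

theorem abs_le_euclNorm {d : ℕ} (x : Fin d → ℤ) (i : Fin d) : |(x i : ℝ)| ≤ euclNorm x := by
  refine abs_le_of_sq_le_sq ?_ (euclNorm_nonneg x)
  rw [euclNorm_sq]
  exact Finset.single_le_sum (f := fun i => (x i : ℝ) ^ 2) (fun _ _ => sq_nonneg _)
    (Finset.mem_univ i)

theorem euclNorm_pos {d : ℕ} {x : Fin d → ℤ} (hx : x ≠ 0) : 0 < euclNorm x := by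
  obtain ⟨i, hi⟩ := Function.ne_iff.1 hx
  refine lt_of_lt_of_le ?_ (abs_le_euclNorm x i)
  simpa using hi

theorem ne_zero_of_euclNorm_pos {d : ℕ} {x : Fin d → ℤ} (hx : 0 < euclNorm x) : x ≠ 0 := by
  rintro rfl
  have h := euclNorm_sq (0 : Fin d → ℤ)
  simp only [Pi.zero_apply, Int.cast_zero, zero_pow two_ne_zero, Finset.sum_const_zero] at h
  exact (pow_pos hx 2).ne' h

/-- The coordinate of largest modulus controls the Euclidean norm. -/
theorem exists_euclNorm_le_mul_natAbs {d : ℕ} {x : Fin d → ℤ} (hx : x ≠ 0) :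
    ∃ i, x i ≠ 0 ∧ euclNorm x ≤ d * (x i).natAbs := by
  obtain ⟨j, hj⟩ := Function.ne_iff.1 hx
  obtain ⟨i, -, hi⟩ := Finset.exists_max_image Finset.univ (fun i => (x i).natAbs)
    ⟨j, Finset.mem_univ j⟩
  have hxi : x i ≠ 0 := by
    have h1 := hi j (Finset.mem_univ j)
    have h2 : x j ≠ 0 := hj
    omega
  refine ⟨i, hxi, ?_⟩
  refine abs_le_of_sq_le_sq' ?_ (by positivity) |>.2
  have hd : (1 : ℝ) ≤ d := by
    have : 0 < d := Fin.pos i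
    exact_mod_cast this
  have hb : ∀ j, (x j : ℝ) ^ 2 ≤ ((x i).natAbs : ℝ) ^ 2 := fun j => by
    have h1 : ((x j).natAbs : ℝ) ≤ (x i).natAbs := by exact_mod_cast hi j (Finset.mem_univ j)
    have h2 : ((x j).natAbs : ℝ) ^ 2 = (x j : ℝ) ^ 2 := by
      rw [Nat.cast_natAbs, Int.cast_abs, sq_abs]
    rw [← h2]
    gcongr
  calc euclNorm x ^ 2 = ∑ i, (x i : ℝ) ^ 2 := euclNorm_sq x
    _ ≤ ∑ _j : Fin d, ((x i).natAbs : ℝ) ^ 2 := Finset.sum_le_sum fun j _ => hb j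
    _ = d * ((x i).natAbs : ℝ) ^ 2 := by simp
    _ ≤ d ^ 2 * ((x i).natAbs : ℝ) ^ 2 := by gcongr; nlinarith
    _ = _ := by ring

/-- The heat kernel `⟨δ_x, e^{tΔ} δ_0⟩` of `ℤ^d`; it factorises over the coordinates. -/
noncomputable def heatKernel {d : ℕ} (t : ℝ) (x : Fin d → ℤ) : ℝ := ∏ i, (latticeHeat t (x i)).re

theorem ofReal_heatKernel {d : ℕ} (t : ℝ) (x : Fin d → ℤ) :
    (heatKernel t x : ℂ) = ∏ i, latticeHeat t (x i) := by
  unfold heatKernel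
  push_cast
  simp only [ofReal_re_latticeHeat]

theorem heatKernel_pos {d : ℕ} {t : ℝ} (ht : 0 < t) (x : Fin d → ℤ) : 0 < heatKernel t x :=
  Finset.prod_pos fun i _ => re_latticeHeat_pos ht (x i)

theorem measurable_heatKernel {d : ℕ} (x : Fin d → ℤ) :
    Measurable fun t => heatKernel t x := by
  have h : ∀ k, Measurable fun t => latticeHeat t k := fun k => by
    unfold latticeHeat
    refine (StronglyMeasurable.integral_prod_right (Continuous.stronglyMeasurable ?_)).measurable
    unfold Function.uncurry
    fun_prop
  unfold heatKernel
  exact Finset.measurable_prod _ fun i _ => Complex.measurable_re.comp (h (x i))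

theorem re_latticeHeat_le_one {t : ℝ} (ht : 0 ≤ t) (k : ℤ) : (latticeHeat t k).re ≤ 1 :=
  (Complex.re_le_norm _).trans
    ((norm_latticeHeat_le_returnProb ht k).trans (returnProb_le_one ht))

theorem sqrt_mul_re_latticeHeat_le_one {t : ℝ} (ht : 0 < t) (k : ℤ) :
    √t * (latticeHeat t k).re ≤ 1 :=
  (mul_le_mul_of_nonneg_left ((Complex.re_le_norm _).trans (norm_latticeHeat_le_returnProb ht.le k))
    (Real.sqrt_nonneg t)).trans (sqrt_mul_returnProb_le ht)

theorem heatKernel_le_one {d : ℕ} {t : ℝ} (ht : 0 < t) (x : Fin d → ℤ) : heatKernel t x ≤ 1 :=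
  Finset.prod_le_one (fun i _ => (re_latticeHeat_pos ht (x i)).le)
    fun i _ => re_latticeHeat_le_one ht.le (x i)

theorem sqrt_pow_mul_heatKernel {d : ℕ} (t : ℝ) (x : Fin d → ℤ) :
    √t ^ d * heatKernel t x = ∏ i, (√t * (latticeHeat t (x i)).re) := by
  rw [Finset.prod_mul_distrib, heatKernel]
  simp

theorem sqrt_pow_mul_heatKernel_le_one {d : ℕ} {t : ℝ} (ht : 0 < t) (x : Fin d → ℤ) :
    √t ^ d * heatKernel t x ≤ 1 := by
  rw [sqrt_pow_mul_heatKernel]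
  exact Finset.prod_le_one
    (fun i _ => mul_nonneg (Real.sqrt_nonneg t) (re_latticeHeat_pos ht (x i)).le)
    fun i _ => sqrt_mul_re_latticeHeat_le_one ht (x i)

/-- The heat kernel decays like `t |x|^{-d-2}`, uniformly in time; this controls small times. -/
theorem exists_pow_mul_heatKernel_le (d : ℕ) :
    ∃ C : ℝ, 0 < C ∧ ∀ (t : ℝ) (x : Fin d → ℤ), 0 < t → x ≠ 0 →
      euclNorm x ^ (d + 2) * heatKernel t x ≤ C * t := by
  set B : ℝ := Real.exp 4 * (d + 2).factorial
  refine ⟨d ^ (d + 2) * B + 1, by positivity, fun t x ht hx => ?_⟩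
  obtain ⟨i, hi, hN⟩ := exists_euclNorm_le_mul_natAbs hx
  have hnorm : ∀ j, (latticeHeat t (x j)).re ≤ ‖latticeHeat t (x j)‖ := fun j =>
    Complex.re_le_norm _
  have hpos : ∀ j, 0 < (latticeHeat t (x j)).re := fun j => re_latticeHeat_pos ht (x j)
  have hs : 0 < √t := Real.sqrt_pos.2 ht
  have key : ((x i).natAbs : ℝ) ^ (d + 2) * heatKernel t x ≤ B * t := by
    rcases le_total t 1 with h | h
    · have h1 := natAbs_pow_mul_norm_latticeHeat_le_of_le_one ht h hi (d + 2)
      have h2 : ∏ j ∈ Finset.univ.erase i, (latticeHeat t (x j)).re ≤ 1 :=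
        Finset.prod_le_one (fun j _ => (hpos j).le) fun j _ => re_latticeHeat_le_one ht.le (x j)
      rw [heatKernel, ← Finset.mul_prod_erase _ _ (Finset.mem_univ i)]
      calc _ ≤ ((x i).natAbs : ℝ) ^ (d + 2) * (‖latticeHeat t (x i)‖ * 1) := by
            gcongr
            · exact Finset.prod_nonneg fun j _ => (hpos j).le
            · exact hnorm i
        _ ≤ _ := by rw [mul_one]; exact h1
    · have h1 := natAbs_pow_mul_norm_latticeHeat_le_of_one_le h (x i) (d + 2)
      have h2 : ∏ j ∈ Finset.univ.erase i, (√t * (latticeHeat t (x j)).re) ≤ 1 :=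
        Finset.prod_le_one (fun j _ => (mul_pos hs (hpos j)).le)
          fun j _ => sqrt_mul_re_latticeHeat_le_one ht (x j)
      have h3 : √t ^ d * (((x i).natAbs : ℝ) ^ (d + 2) * heatKernel t x) ≤ √t ^ d * (B * t) := by
        calc √t ^ d * (((x i).natAbs : ℝ) ^ (d + 2) * heatKernel t x)
            = ((x i).natAbs : ℝ) ^ (d + 2) * (√t ^ d * heatKernel t x) := by ring
          _ = ((x i).natAbs : ℝ) ^ (d + 2) * ((√t * (latticeHeat t (x i)).re) *
              ∏ j ∈ Finset.univ.erase i, (√t * (latticeHeat t (x j)).re)) := by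
              rw [sqrt_pow_mul_heatKernel, ← Finset.mul_prod_erase _ _ (Finset.mem_univ i)]
          _ ≤ ((x i).natAbs : ℝ) ^ (d + 2) * ((√t * ‖latticeHeat t (x i)‖) * 1) := by
              gcongr
              · exact Finset.prod_nonneg fun j _ => (mul_pos hs (hpos j)).le
              · exact hnorm i
          _ = ((x i).natAbs : ℝ) ^ (d + 2) * ‖latticeHeat t (x i)‖ * √t := by ring
          _ ≤ Real.exp 2 * (d + 2).factorial * √t ^ (d + 2) := h1
          _ ≤ B * √t ^ (d + 2) := by
              simp only [B]
              gcongr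
              norm_num
          _ = √t ^ d * (B * t) := by
              rw [pow_add, Real.sq_sqrt ht.le]; ring
      exact le_of_mul_le_mul_left h3 (by positivity)
  calc euclNorm x ^ (d + 2) * heatKernel t x
      ≤ (d * (x i).natAbs) ^ (d + 2) * heatKernel t x := by
        have := (heatKernel_pos ht x).le
        have := euclNorm_nonneg x
        gcongr
    _ = d ^ (d + 2) * (((x i).natAbs : ℝ) ^ (d + 2) * heatKernel t x) := by ring
    _ ≤ d ^ (d + 2) * (B * t) := by gcongr
    _ ≤ _ := by nlinarith

/-! ### Diffusive scaling -/

/-- The heat kernel on the diffusive time scale `t = |x|² s`. -/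
noncomputable def scaledHeat {d : ℕ} (x : Fin d → ℤ) (s : ℝ) : ℝ :=
  euclNorm x ^ d * heatKernel (euclNorm x ^ 2 * s) x

theorem exists_scaledHeat_le (d : ℕ) :
    ∃ C : ℝ, 0 < C ∧ ∀ (x : Fin d → ℤ) (s : ℝ), x ≠ 0 → 0 < s →
      scaledHeat x s ≤ C * min s 1 := by
  obtain ⟨C, hC, h⟩ := exists_pow_mul_heatKernel_le d
  refine ⟨max C 1, by positivity, fun x s hx hs => ?_⟩
  have hN := euclNorm_pos hx
  have ht : 0 < euclNorm x ^ 2 * s := by positivity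
  unfold scaledHeat
  rcases le_total s 1 with h1 | h1
  · rw [min_eq_left h1]
    refine (?_ : _ ≤ C * s).trans (by gcongr; exact le_max_left _ _)
    have h2 := h _ x ht hx
    refine le_of_mul_le_mul_left (a := euclNorm x ^ 2) ?_ (by positivity)
    calc _ = euclNorm x ^ (d + 2) * heatKernel (euclNorm x ^ 2 * s) x := by ring
      _ ≤ C * (euclNorm x ^ 2 * s) := h2
      _ = _ := by ring
  · rw [min_eq_right h1, mul_one]
    refine le_trans ?_ (le_max_right C 1)
    have h2 := sqrt_pow_mul_heatKernel_le_one ht x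
    rw [Real.sqrt_mul (by positivity), Real.sqrt_sq hN.le, mul_pow] at h2
    have h3 : 1 ≤ √s ^ d := one_le_pow₀ (Real.one_le_sqrt.2 h1)
    have h4 : 0 < heatKernel (euclNorm x ^ 2 * s) x := heatKernel_pos ht x
    refine le_trans ?_ h2
    calc euclNorm x ^ d * heatKernel (euclNorm x ^ 2 * s) x
        = euclNorm x ^ d * 1 * heatKernel (euclNorm x ^ 2 * s) x := by ring
      _ ≤ _ := by gcongr

theorem tendsto_prod_sub_prod {ι κ : Type*} {l : Filter κ} {a b : ι → κ → ℝ}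
    (hab : ∀ i, Tendsto (fun p => a i p - b i p) l (𝓝 0)) (hb : ∀ i p, |b i p| ≤ 1)
    (S : Finset ι) : Tendsto (fun p => ∏ i ∈ S, a i p - ∏ i ∈ S, b i p) l (𝓝 0) := by
  classical
  induction S using Finset.induction_on with
  | empty => simpa using tendsto_const_nhds
  | insert i S hi ih =>
    have hB : ∀ p, |∏ j ∈ S, b j p| ≤ 1 := fun p => by
      rw [Finset.abs_prod]
      exact Finset.prod_le_one (fun _ _ => abs_nonneg _) fun j _ => hb j p
    have h1 := (hab i).mul ih
    have h2 : Tendsto (fun p => (a i p - b i p) * ∏ j ∈ S, b j p) l (𝓝 0) := by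
      refine squeeze_zero_norm (fun p => ?_) (tendsto_zero_iff_norm_tendsto_zero.1 (hab i))
      rw [norm_mul]
      exact mul_le_of_le_one_right (norm_nonneg _) (hB p)
    have h3 : Tendsto (fun p => b i p * (∏ j ∈ S, a j p - ∏ j ∈ S, b j p)) l (𝓝 0) := by
      refine squeeze_zero_norm (fun p => ?_) (tendsto_zero_iff_norm_tendsto_zero.1 ih)
      rw [norm_mul]
      exact mul_le_of_le_one_left (norm_nonneg _) (hb i p)
    have h := (h1.add h2).add h3
    simp only [mul_zero, add_zero] at h
    refine h.congr fun p => ?_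
    rw [Finset.prod_insert hi, Finset.prod_insert hi]
    ring

/-- The local central limit theorem: the limit is the Gaussian heat kernel at distance `1`. -/
theorem tendsto_scaledHeat {d : ℕ} {s : ℝ} (hs : 0 < s) :
    Tendsto (fun x : Fin d → ℤ => scaledHeat x s) (comap euclNorm atTop)
      (𝓝 ((√s)⁻¹ ^ d * ((2 * √Real.pi)⁻¹ ^ d * Real.exp (-(1 / (4 * s)))))) := by
  have hN : Tendsto (euclNorm : (Fin d → ℤ) → ℝ) (comap euclNorm atTop) atTop := tendsto_comap
  have ht : Tendsto (fun x : Fin d → ℤ => euclNorm x ^ 2 * s) (comap euclNorm atTop) atTop :=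
    ((tendsto_pow_atTop two_ne_zero).comp hN).atTop_mul_const hs
  have hNpos : ∀ᶠ x : Fin d → ℤ in comap euclNorm atTop, 0 < euclNorm x :=
    hN.eventually (eventually_gt_atTop 0)
  have hππ : 1 ≤ √Real.pi := Real.one_le_sqrt.2 (by linarith [Real.two_le_pi])
  let a : Fin d → (Fin d → ℤ) → ℝ := fun i x =>
    √(euclNorm x ^ 2 * s) * (latticeHeat (euclNorm x ^ 2 * s) (x i)).re
  let b : Fin d → (Fin d → ℤ) → ℝ := fun i x =>
    (2 * √Real.pi)⁻¹ * Real.exp (-((x i : ℝ) ^ 2 / (4 * (euclNorm x ^ 2 * s))))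
  have hab : ∀ i, Tendsto (fun x => a i x - b i x) (comap euclNorm atTop) (𝓝 0) := by
    intro i
    have h0 := (tendsto_integral_rescaled_sub_gaussian.const_mul (2 * Real.pi)⁻¹).comp ht
    rw [mul_zero] at h0
    refine squeeze_zero_norm' ?_ h0
    filter_upwards [hNpos] with x hx
    have h1 := norm_sqrt_mul_latticeHeat_sub_le (t := euclNorm x ^ 2 * s) (by positivity) (x i)
    refine le_trans (le_of_eq ?_) h1
    rw [← ofReal_re_latticeHeat, ← Complex.ofReal_mul, ← Complex.ofReal_sub, Complex.norm_real]
  have hb : ∀ i x, |b i x| ≤ 1 := fun i x => by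
    have h1 : (2 * √Real.pi)⁻¹ ≤ 1 := inv_le_one_of_one_le₀ (by linarith)
    have h2 : Real.exp (-((x i : ℝ) ^ 2 / (4 * (euclNorm x ^ 2 * s)))) ≤ 1 := by
      rw [Real.exp_le_one_iff, neg_nonpos]
      positivity
    rw [abs_of_nonneg (by positivity)]
    exact mul_le_one₀ h1 (Real.exp_pos _).le h2
  have hprod := (tendsto_prod_sub_prod hab hb Finset.univ).add_const
    ((2 * √Real.pi)⁻¹ ^ d * Real.exp (-(1 / (4 * s))))
  rw [zero_add] at hprod
  refine (hprod.const_mul ((√s)⁻¹ ^ d)).congr' ?_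
  filter_upwards [hNpos] with x hx
  have e1 : ∏ i, a i x = √(euclNorm x ^ 2 * s) ^ d * heatKernel (euclNorm x ^ 2 * s) x :=
    (sqrt_pow_mul_heatKernel _ _).symm
  have e2 : ∏ i, b i x = (2 * √Real.pi)⁻¹ ^ d * Real.exp (-(1 / (4 * s))) := by
    simp only [b]
    rw [Finset.prod_mul_distrib, ← Real.exp_sum, Finset.sum_neg_distrib, ← Finset.sum_div,
      ← euclNorm_sq]
    simp only [Finset.prod_const, Finset.card_univ, Fintype.card_fin]
    congr 3
    field_simp
  have hss : 0 < √s := Real.sqrt_pos.2 hs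
  rw [e1, e2, sub_add_cancel, scaledHeat, Real.sqrt_mul (by positivity), Real.sqrt_sq hx.le,
    mul_pow, inv_pow]
  field_simp

/-! ### The off-diagonal kernel -/

/-- The kernel of `-(-Δ)^α` at displacement `x ≠ 0`. -/
noncomputable def fracKernel {d : ℕ} (α : ℝ) (x : Fin d → ℤ) : ℝ :=
  |Real.Gamma (-α)|⁻¹ * ∫ t in Ioi (0 : ℝ), t ^ (-1 - α) * heatKernel t x

theorem neg_matrixElement_eq_fracKernel {d : ℕ} {α : ℝ} (hα0 : 0 < α) (hα1 : α < 1)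
    {n m : Fin d → ℤ} (hnm : n ≠ m) :
    -matrixElement (fracLaplacian d α) n m = (fracKernel α (n - m) : ℂ) := by
  rw [neg_matrixElement_fracLaplacian hα0 hα1 hnm, fracKernel, Complex.ofReal_mul,
    ← integral_complex_ofReal]
  simp only [← ofReal_heatKernel, Complex.ofReal_mul]

theorem integrableOn_rpow_mul_heatKernel {d : ℕ} {α : ℝ} (hα0 : 0 < α) (hα1 : α < 1)
    {x : Fin d → ℤ} (hx : x ≠ 0) :
    IntegrableOn (fun t : ℝ => t ^ (-1 - α) * heatKernel t x) (Ioi 0) := by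
  obtain ⟨C, hC, h⟩ := exists_pow_mul_heatKernel_le d
  have hN := euclNorm_pos hx
  refine Integrable.mono' ((integrableOn_min_mul_rpow hα0 hα1).const_mul
    (max (C / euclNorm x ^ (d + 2)) 1)) ?_ ?_
  · have := measurable_heatKernel x
    exact Measurable.aestronglyMeasurable (by fun_prop)
  · refine (ae_restrict_mem measurableSet_Ioi).mono fun t ht => ?_
    have ht' : (0 : ℝ) < t := ht
    have hp := heatKernel_pos ht' x
    rw [Real.norm_of_nonneg (by positivity), mul_comm, ← mul_assoc]
    gcongr
    rcases le_total t 1 with h1 | h1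
    · rw [min_eq_left h1]
      refine le_trans ?_ (mul_le_mul_of_nonneg_right (le_max_left _ _) ht'.le)
      rw [div_mul_eq_mul_div, le_div_iff₀ (by positivity), mul_comm]
      exact h t x ht' hx
    · rw [min_eq_right h1, mul_one]
      exact (heatKernel_le_one ht' x).trans (le_max_right _ _)

theorem fracKernel_pos {d : ℕ} {α : ℝ} (hα0 : 0 < α) (hα1 : α < 1) {x : Fin d → ℤ}
    (hx : x ≠ 0) : 0 < fracKernel α x := by
  have hpos : ∀ t ∈ Ioi (0 : ℝ), 0 < t ^ (-1 - α) * heatKernel t x := fun t ht =>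
    mul_pos (Real.rpow_pos_of_pos ht _) (heatKernel_pos ht x)
  refine mul_pos (inv_pos.2 (abs_Gamma_neg_pos hα0 hα1)) ?_
  rw [setIntegral_pos_iff_support_of_nonneg_ae
    ((ae_restrict_mem measurableSet_Ioi).mono fun t ht => (hpos t ht).le)
    (integrableOn_rpow_mul_heatKernel hα0 hα1 hx)]
  rw [inter_eq_self_of_subset_right
    (fun t ht => Function.mem_support.2 (hpos t ht).ne' : Ioi (0 : ℝ) ⊆ _)]
  simp

/-- The substitution `t = |x|² s`. -/
theorem euclNorm_rpow_mul_fracKernel {d : ℕ} {α : ℝ} {x : Fin d → ℤ} (hx : x ≠ 0) :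
    euclNorm x ^ ((d : ℝ) + 2 * α) * fracKernel α x =
      |Real.Gamma (-α)|⁻¹ * ∫ s in Ioi (0 : ℝ), s ^ (-1 - α) * scaledHeat x s := by
  have hN := euclNorm_pos hx
  have hN2 : 0 < euclNorm x ^ 2 := by positivity
  have h := integral_comp_mul_left_Ioi (fun t : ℝ => t ^ (-1 - α) * heatKernel t x) 0 hN2
  rw [mul_zero, smul_eq_mul] at h
  have h2 : ∫ t in Ioi (0 : ℝ), t ^ (-1 - α) * heatKernel t x = euclNorm x ^ 2 *
      ∫ s in Ioi (0 : ℝ), (euclNorm x ^ 2 * s) ^ (-1 - α) * heatKernel (euclNorm x ^ 2 * s) x := by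
    rw [h, mul_inv_cancel_left₀ hN2.ne']
  rw [fracKernel, h2, mul_left_comm, ← mul_assoc (euclNorm x ^ ((d : ℝ) + 2 * α)),
    ← integral_const_mul]
  congr 1
  refine setIntegral_congr_fun measurableSet_Ioi fun s hs => ?_
  have hs' : (0 : ℝ) < s := hs
  have e : euclNorm x ^ ((d : ℝ) + 2 * α) * euclNorm x ^ 2 * (euclNorm x ^ 2) ^ (-1 - α) =
      euclNorm x ^ d := by
    rw [← Real.rpow_natCast _ 2, ← Real.rpow_natCast _ d, ← Real.rpow_mul hN.le,
      ← Real.rpow_add hN, ← Real.rpow_add hN]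
    congr 1
    push_cast
    ring
  simp only [scaledHeat]
  rw [Real.mul_rpow hN2.le hs'.le, ← e]
  ring

/-- After `s ↦ 1/s` the integral is Euler's integral for `Γ(d/2 + α)`. -/
theorem integral_gaussian_heat (d : ℕ) {α : ℝ} (hα0 : 0 < α) :
    ∫ s in Ioi (0 : ℝ), s ^ (-1 - α) *
        ((√s)⁻¹ ^ d * ((2 * √Real.pi)⁻¹ ^ d * Real.exp (-(1 / (4 * s))))) =
      (4 : ℝ) ^ α * Real.Gamma ((d : ℝ) / 2 + α) / Real.pi ^ ((d : ℝ) / 2) := by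
  have hπ := Real.pi_pos
  rw [← integral_comp_rpow_Ioi _ (show (-1 : ℝ) ≠ 0 by norm_num)]
  have e : ∀ u ∈ Ioi (0 : ℝ), (|(-1 : ℝ)| * u ^ ((-1 : ℝ) - 1)) • ((u ^ (-1 : ℝ)) ^ (-1 - α) *
      ((√(u ^ (-1 : ℝ)))⁻¹ ^ d * ((2 * √Real.pi)⁻¹ ^ d *
        Real.exp (-(1 / (4 * u ^ (-1 : ℝ))))))) =
      (2 * √Real.pi)⁻¹ ^ d * (u ^ ((d : ℝ) / 2 + α - 1) * Real.exp (-(1 / 4 * u))) := by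
    intro u hu
    have hu' : (0 : ℝ) < u := hu
    have e1 : (√(u ^ (-1 : ℝ)))⁻¹ ^ d = u ^ ((d : ℝ) / 2) := by
      rw [Real.rpow_neg_one, Real.sqrt_inv, inv_inv, Real.sqrt_eq_rpow, ← Real.rpow_natCast,
        ← Real.rpow_mul hu'.le]
      congr 1
      ring
    have e2 : u ^ ((-1 : ℝ) - 1) * (u ^ (-1 : ℝ)) ^ (-1 - α) * u ^ ((d : ℝ) / 2) =
        u ^ ((d : ℝ) / 2 + α - 1) := by
      rw [← Real.rpow_mul hu'.le, ← Real.rpow_add hu', ← Real.rpow_add hu']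
      congr 1
      ring
    have e3 : -(1 / (4 * u ^ (-1 : ℝ))) = -(1 / 4 * u) := by
      rw [Real.rpow_neg_one]
      field_simp
    rw [e1, e3, ← e2, abs_neg, abs_one, smul_eq_mul]
    ring
  rw [setIntegral_congr_fun measurableSet_Ioi e, integral_const_mul,
    Real.integral_rpow_mul_exp_neg_mul_Ioi (by positivity) (by norm_num)]
  have e4 : (2 * √Real.pi)⁻¹ ^ d = ((4 : ℝ) ^ ((d : ℝ) / 2))⁻¹ * (Real.pi ^ ((d : ℝ) / 2))⁻¹ := by
    have h4 : (2 : ℝ) = √4 := by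
      rw [show (4 : ℝ) = 2 ^ 2 by norm_num, Real.sqrt_sq (by norm_num)]
    rw [h4, ← Real.sqrt_mul (by norm_num), inv_pow, Real.sqrt_eq_rpow, ← Real.rpow_natCast,
      ← Real.rpow_mul (by positivity), ← mul_inv, ← Real.mul_rpow (by norm_num) hπ.le]
    congr 2
    rw [← h4]
    ring
  rw [e4, show (1 : ℝ) / (1 / 4) = 4 by norm_num, Real.rpow_add (by norm_num)]
  have : (4 : ℝ) ^ ((d : ℝ) / 2) ≠ 0 := by positivity
  field_simp

theorem tendsto_fracKernel {d : ℕ} {α : ℝ} (hα0 : 0 < α) (hα1 : α < 1) :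
    Tendsto (fun x : Fin d → ℤ => euclNorm x ^ ((d : ℝ) + 2 * α) * fracKernel α x)
      (comap euclNorm atTop) (𝓝 (limitConst d α)) := by
  have hne : ∀ᶠ x : Fin d → ℤ in comap euclNorm atTop, x ≠ 0 :=
    (tendsto_comap.eventually (eventually_gt_atTop 0)).mono fun x hx => ne_zero_of_euclNorm_pos hx
  obtain ⟨C, hC, hb⟩ := exists_scaledHeat_le d
  have hlim : Tendsto (fun x : Fin d → ℤ => ∫ s in Ioi (0 : ℝ), s ^ (-1 - α) * scaledHeat x s)
      (comap euclNorm atTop) (𝓝 (∫ s in Ioi (0 : ℝ), s ^ (-1 - α) *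
        ((√s)⁻¹ ^ d * ((2 * √Real.pi)⁻¹ ^ d * Real.exp (-(1 / (4 * s))))))) := by
    refine tendsto_integral_filter_of_dominated_convergence
      (fun s => C * (min s 1 * s ^ (-1 - α))) ?_ ?_
      ((integrableOn_min_mul_rpow hα0 hα1).const_mul C) ?_
    · refine Eventually.of_forall fun x => Measurable.aestronglyMeasurable ?_
      have : Measurable fun s => scaledHeat x s :=
        ((measurable_heatKernel x).comp (measurable_const_mul _)).const_mul _
      fun_prop
    · filter_upwards [hne] with x hx
      refine (ae_restrict_mem measurableSet_Ioi).mono fun s hs => ?_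
      have hs' : (0 : ℝ) < s := hs
      have hN := euclNorm_pos hx
      have h0 : 0 < scaledHeat x s :=
        mul_pos (by positivity) (heatKernel_pos (by positivity) x)
      rw [Real.norm_of_nonneg (by positivity), mul_comm, ← mul_assoc]
      gcongr
      exact hb x s hx hs'
    · exact (ae_restrict_mem measurableSet_Ioi).mono fun s hs =>
        (tendsto_scaledHeat hs).const_mul _
  rw [integral_gaussian_heat d hα0] at hlim
  have h := hlim.const_mul |Real.Gamma (-α)|⁻¹
  have e : |Real.Gamma (-α)|⁻¹ * ((4 : ℝ) ^ α * Real.Gamma ((d : ℝ) / 2 + α) /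
      Real.pi ^ ((d : ℝ) / 2)) = limitConst d α := by
    unfold limitConst
    rw [← div_div, inv_mul_eq_div]
  rw [e] at h
  refine h.congr' ?_
  filter_upwards [hne] with x hx
  exact (euclNorm_rpow_mul_fracKernel hx).symm

theorem limitConst_pos (d : ℕ) {α : ℝ} (hα0 : 0 < α) (hα1 : α < 1) : 0 < limitConst d α := by
  have h1 := abs_Gamma_neg_pos hα0 hα1
  have h2 : 0 < Real.Gamma ((d : ℝ) / 2 + α) := Real.Gamma_pos_of_pos (by positivity)
  have := Real.pi_pos
  unfold limitConst
  positivity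

theorem finite_euclNorm_lt (d : ℕ) (R : ℝ) : {x : Fin d → ℤ | euclNorm x < R}.Finite := by
  refine (finite_Icc (fun _ => -⌈R⌉ : Fin d → ℤ) (fun _ => ⌈R⌉)).subset fun x hx => ?_
  have h : ∀ i, |x i| ≤ ⌈R⌉ := fun i => by
    have h1 : ((|x i| : ℤ) : ℝ) < R := by
      rw [Int.cast_abs]; exact (abs_le_euclNorm x i).trans_lt hx
    exact_mod_cast h1.le.trans (Int.le_ceil R)
  exact ⟨fun i => (abs_le.1 (h i)).1, fun i => (abs_le.1 (h i)).2⟩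

/-- A positive function with a positive limit at infinity is bounded above and below, as only
finitely many lattice points lie in any ball. -/
theorem exists_bounds_of_tendsto {d : ℕ} {f : (Fin d → ℤ) → ℝ} {L : ℝ} (hL : 0 < L)
    (hf : Tendsto f (comap euclNorm atTop) (𝓝 L)) (hpos : ∀ x, x ≠ 0 → 0 < f x) :
    ∃ c C : ℝ, 0 < c ∧ 0 < C ∧ ∀ x, x ≠ 0 → c ≤ f x ∧ f x ≤ C := by
  have hev : ∀ᶠ x in comap euclNorm atTop, f x ∈ Ioo (L / 2) (2 * L) :=
    hf.eventually (Ioo_mem_nhds (by linarith) (by linarith))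
  rw [eventually_comap, eventually_atTop] at hev
  obtain ⟨R, hR⟩ := hev
  obtain ⟨B, hB⟩ := ((finite_euclNorm_lt d R).image fun x => max (f x) (f x)⁻¹).bddAbove
  have hB' : ∀ x, euclNorm x < R → f x ≤ B ∧ (f x)⁻¹ ≤ B := fun x hx =>
    max_le_iff.1 (hB ⟨x, hx, rfl⟩)
  refine ⟨min (L / 2) (max B 1)⁻¹, max (2 * L) B, by positivity, by positivity, fun x hx => ?_⟩
  have hfx := hpos x hx
  rcases lt_or_ge (euclNorm x) R with h | h
  · obtain ⟨h1, h2⟩ := hB' x h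
    refine ⟨(min_le_right _ _).trans ?_, h1.trans (le_max_right _ _)⟩
    exact inv_le_of_inv_le₀ hfx (h2.trans (le_max_left _ _))
  · have := hR _ h x rfl
    exact ⟨(min_le_left _ _).trans this.1.le, this.2.le.trans (le_max_left _ _)⟩

/-! ### The diagonal -/

theorem integral_symbol (d : ℕ) :
    ∫ θ : Fin d → ℝ, symbol θ ∂torusMeasure d = 2 * d := by
  have hi : ∀ x : Fin d → ℤ, Integrable (planeWave x) (torusMeasure d) := fun x => by
    simpa using integrable_comp_symbol (f := fun _ => 1) continuous_const x
  have h : (∫ θ : Fin d → ℝ, (symbol θ : ℂ) ∂torusMeasure d) = 2 * d := by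
    have e : ∀ θ : Fin d → ℝ, (symbol θ : ℂ) =
        ∑ i, ((planeWave 0 θ - planeWave (0 + Pi.single i 1) θ) +
          (planeWave 0 θ - planeWave (0 - Pi.single i 1) θ)) := fun θ => by
      rw [symbol_mul_planeWave, planeWave_zero, mul_one]
    simp only [e]
    rw [integral_finsetSum]
    · have e2 : ∀ i : Fin d, ∫ θ, ((planeWave 0 θ - planeWave (0 + Pi.single i 1) θ) +
          (planeWave 0 θ - planeWave (0 - Pi.single i 1) θ)) ∂torusMeasure d = 2 := fun i => by
        have h1 := integral_add ((hi 0).sub (hi (0 + Pi.single i 1)))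
          ((hi 0).sub (hi (0 - Pi.single i 1)))
        simp only [Pi.sub_apply] at h1
        rw [h1, integral_sub (hi _) (hi _), integral_sub (hi _) (hi _)]
        simp only [integral_planeWave]
        simp
        norm_num
      simp only [e2]
      simp [mul_comm]
    · exact fun i _ => ((hi _).sub (hi _)).add ((hi _).sub (hi _))
  rw [integral_complex_ofReal] at h
  exact_mod_cast h

theorem integral_symbol_rpow_pos {d : ℕ} (hd : 1 ≤ d) {α : ℝ} (hα0 : 0 < α) :
    0 < ∫ θ : Fin d → ℝ, symbol θ ^ α ∂torusMeasure d := by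
  have hnn : ∀ θ : Fin d → ℝ, 0 ≤ symbol θ ^ α := fun θ => Real.rpow_nonneg (symbol_nonneg θ) α
  have hint : Integrable (fun θ : Fin d → ℝ => symbol θ ^ α) (torusMeasure d) := by
    have h := (integrable_comp_symbol (d := d) (Real.continuous_rpow_const hα0.le) 0).re
    simpa [planeWave_zero] using h
  refine lt_of_le_of_ne (integral_nonneg hnn) fun h => ?_
  -- a vanishing integral would force `symbol = 0` almost everywhere, but `symbol` has mean `2 d`
  rw [eq_comm, integral_eq_zero_iff_of_nonneg hnn hint] at h
  have h0 : ∫ θ : Fin d → ℝ, symbol θ ∂torusMeasure d = 0 := by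
    refine integral_eq_zero_of_ae (h.mono fun θ hθ => ?_)
    exact (Real.rpow_eq_zero (symbol_nonneg θ) hα0.ne').1 hθ
  rw [integral_symbol] at h0
  have : (1 : ℝ) ≤ d := by exact_mod_cast hd
  linarith

end DiscreteFractionalLaplacian

open DiscreteFractionalLaplacian in
open scoped ComplexOrder in
/-- Inequalities between complex numbers are those of `ComplexOrder`: `z ≤ w` (`z < w`) means
that `z.re ≤ w.re` (`z.re < w.re`) and `z.im = w.im`. In particular, they assert that the matrix
elements are real. The limit is along all pairs `(n, m)` with `|n - m| → ∞`. -/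
theorem theorem2p2 (d : ℕ) (hd : 1 ≤ d) (α : ℝ) (hα0 : 0 < α) (hα1 : α < 1) :
    ((∀ n m : Fin d → ℤ, n ≠ m → matrixElement (fracLaplacian d α) n m < 0) ∧
      (∀ n : Fin d → ℤ, 0 < matrixElement (fracLaplacian d α) n n)) ∧
    (0 < limitConst d α ∧
      Filter.Tendsto
        (fun p : (Fin d → ℤ) × (Fin d → ℤ) =>
          ((euclNorm (p.1 - p.2) ^ ((d : ℝ) + 2 * α) : ℝ) : ℂ) *
            (-matrixElement (fracLaplacian d α) p.1 p.2))
        (Filter.comap (fun p : (Fin d → ℤ) × (Fin d → ℤ) => euclNorm (p.1 - p.2)) Filter.atTop)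
        (nhds ((limitConst d α : ℝ) : ℂ))) ∧
    (∃ c C : ℝ, 0 < c ∧ 0 < C ∧ ∀ n m : Fin d → ℤ, n ≠ m →
      ((c / euclNorm (n - m) ^ ((d : ℝ) + 2 * α) : ℝ) : ℂ) ≤
          -matrixElement (fracLaplacian d α) n m ∧
        -matrixElement (fracLaplacian d α) n m ≤
          ((C / euclNorm (n - m) ^ ((d : ℝ) + 2 * α) : ℝ) : ℂ)) := by

  have hfrac : ∀ {n m : Fin d → ℤ}, n ≠ m →
      -matrixElement (fracLaplacian d α) n m = (fracKernel α (n - m) : ℂ) :=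
    fun hnm => neg_matrixElement_eq_fracKernel hα0 hα1 hnm
  refine ⟨⟨fun n m hnm => ?_, fun n => ?_⟩, ⟨limitConst_pos d hα0 hα1, ?_⟩, ?_⟩
  · rw [← neg_pos, hfrac hnm]
    exact Complex.zero_lt_real.2 (fracKernel_pos hα0 hα1 (sub_ne_zero.2 hnm))
  · rw [matrixElement_fracLaplacian_diag hα0]
    exact Complex.zero_lt_real.2 (integral_symbol_rpow_pos hd hα0)
  · have hsub : Filter.Tendsto (fun p : (Fin d → ℤ) × (Fin d → ℤ) => p.1 - p.2)
        (Filter.comap (fun p : (Fin d → ℤ) × (Fin d → ℤ) => euclNorm (p.1 - p.2)) Filter.atTop)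
        (Filter.comap euclNorm Filter.atTop) :=
      Filter.tendsto_comap_iff.2 Filter.tendsto_comap
    have hlim := (Complex.continuous_ofReal.tendsto _).comp
      ((tendsto_fracKernel hα0 hα1).comp hsub)
    refine hlim.congr' ?_
    filter_upwards [Filter.tendsto_comap.eventually (Filter.eventually_gt_atTop 0)] with p hp
    rw [hfrac (sub_ne_zero.1 (ne_zero_of_euclNorm_pos hp)), ← Complex.ofReal_mul]
    rfl
  · obtain ⟨c, C, hc, hC, h⟩ := exists_bounds_of_tendsto (limitConst_pos d hα0 hα1)
      (tendsto_fracKernel hα0 hα1) fun x hx =>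
        mul_pos (Real.rpow_pos_of_pos (euclNorm_pos hx) _) (fracKernel_pos hα0 hα1 hx)
    refine ⟨c, C, hc, hC, fun n m hnm => ?_⟩
    have hx : n - m ≠ 0 := sub_ne_zero.2 hnm
    have hN : 0 < euclNorm (n - m) ^ ((d : ℝ) + 2 * α) := Real.rpow_pos_of_pos (euclNorm_pos hx) _
    rw [hfrac hnm, Complex.real_le_real, Complex.real_le_real, div_le_iff₀' hN, le_div_iff₀' hN]
    exact h _ hx
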